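/- Let $k$ be a field and let $R=\bigoplus_{m\ge 0}R_m$ be a graded $k$-algebra that is an integral domain of Krull dimension $d+1$ with $d\ge 0$. Let $\hat\nu:R\setminus\{0\}\to\mathbb N\times\mathbb Z^r$ be a fully homogeneous valuation. This means that, for some translation-invariant total order on $\mathbb N\times\mathbb Z^r$, one has $\hat\nu(fg)=\hat\nu(f)+\hat\nu(g)$, $\hat\nu(f+g)\le\max\{\hat\nu(f),\hat\nu(g)\}$ and $\hat\nu(cf)=\hat\nu(f)$ for $c\in k^*$, and that the first component of $\hat\nu(f)$ is $\deg f$ for nonzero homogeneous $f$. Assume that the value semigroup $S=\hat\nu(R\setminus\{0\})$ is finitely generated and that $\hat\nu$ has full rank, i.e. the subgroup of $\mathbb Z\times\mathbb Z^r$ generated by $S$ has rank $d+1$. Grade the semigroup algebra $k[S]$, with basis $\chi^s$ $(s\in S)$, by the first component of $s$. Let $k[x_0,\dots,x_n]\to R$, $x_i\mapsto b_i$, be a surjective $k$-algebra map with kernel $J$, where $b_i\in R_{e_i}$ with $e_i>0$. For $w\in\mathbb R^{n+1}$ let $\operatorname{in}_w(J)$ be the ideal generated by the forms $\operatorname{in}_w(f)$,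 $f\in J$, where $\operatorname{in}_w(f)$ is the sum of the terms of $f$ of minimal $w$-weight. The Gröbner fan of $J$ consists of the closures of the classes of weights $w$ with the same initial ideal. For a cone $C$ of this fan, $\operatorname{in}_C(J)$ denotes $\operatorname{in}_w(J)$ for $w$ in the relative interior of $C$. The tropicalization $\mathcal T(J)$ is the subfan of cones whose initial ideal contains no monomial. Assume that $\tau$ is a maximal cone of $\mathcal T(J)$ with $k[S]\cong k[x_0,\dots,x_n]/\operatorname{in}_\tau(J)$ as $k$-algebras. Then there is a maximal cone $C$ of the Gröbner fan of $J$, whose set of standard monomials $\mathbb B_C=\{\bar x^m\in R : x^m\notin\operatorname{in}_C(J)\}$ is a $k$-basis of $R$ (with distinct exponents giving distinct elements), together with an injective $k$-algebra homomorphism $\eta:k[S]\to R$ and an integer $N>0$, such that: 1. $\eta(\chi^s)\in\mathbb B_C$ for every $s\in S$, in particular for every generator of $S$ and for $s=\hat\nu(b_i)$ for all $i$. 2. $\eta(k[S]_m)\subseteq R_{Nm}$ for every $m\ge 0$. 3. There are distinct indices $i_0,\dots,i_d$ such that $b_{i_0},\dots,b_{i_d}$ are algebraically independent over $k$, and $\eta$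 is the composite of a $k$-algebra map $\theta:k[S]\to k[y_0,\dots,y_d]$ with the map $\rho:k[y_0,\dots,y_d]\to R$, $y_j\mapsto b_{i_j}$. Here $\deg y_j=e_{i_j}$, the map $\theta$ sends degree $m$ to degree $Nm$, and $\rho$ preserves degrees. 4. Let $P=\operatorname{Proj}k[y_0,\dots,y_d]$, which is $\mathbb P^d$ when all $e_{i_j}=1$. The open set $U=\operatorname{Proj}(R)\setminus V(\eta(k[S]_+)R)$ is dense in $\operatorname{Proj}(R)$, and $\eta$ induces a dominant morphism $\varphi:U\to\operatorname{Proj}(k[S])$, hence a dominant rational map from $\operatorname{Proj}R$ to $\operatorname{Proj}k[S]$. Moreover $\varphi=\chi\circ\psi$, where $\psi:U\to P\setminus V(\theta(k[S]_+))$ is induced by $\rho$ and $\chi:P\setminus V(\theta(k[S]_+))\to\operatorname{Proj}(k[S])$ is induced by $\theta$. Here a morphism is called induced by a ring map $s:B\to A$ that multiplies degrees by some positive integer if, over each $D_+(f)$ with $f\in B$ homogeneous of positive degree, it is given by $B_{(f)}\to A_{(s(f))}$, $g/f^l\mapsto s(g)/s(f)^l$. -/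

import Mathlib

universe u

open CategoryTheory AlgebraicGeometry HomogeneousLocalization

attribute [local instance] MvPolynomial.weightedGradedAlgebra

noncomputable section

namespace ToricEmbedding

/-! ### Valuations -/

/-- A fully homogeneous (Krull) valuation `ν : R \ {0} → ℕ × ℤ ^ r` on a graded `k`-algebra `R`,
with respect to some translation invariant total order `le` on `ℕ × ℤ ^ r`; the first component
of the value of a homogeneous element is its degree. The value of `toFun` at `0` is irrelevant.

Since the order is arbitrary, passing to the opposite order turns the maximum convention used here
into the minimum convention. As nonzero homogeneous elements of different degrees have different
values, `ν f` is automatically the maximum of the values of the homogeneous components of `f`. -/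
structure HomogeneousValuation (k : Type*) {R : Type*} [Field k] [CommRing R] [Algebra k R]
    (𝒜 : ℕ → Submodule k R) (r : ℕ) where
  /-- the total order on `ℕ × ℤ ^ r` -/
  le : ℕ × (Fin r → ℤ) → ℕ × (Fin r → ℤ) → Prop
  le_total : ∀ a b, le a b ∨ le b a
  le_antisymm : ∀ a b, le a b → le b a → a = b
  le_trans : ∀ a b c, le a b → le b c → le a c
  add_le_add_iff : ∀ a b c, le (a + c) (b + c) ↔ le a b
  /-- the valuation -/
  toFun : R → ℕ × (Fin r → ℤ)
  map_mul : ∀ f g : R, f ≠ 0 → g ≠ 0 → toFun (f * g) = toFun f + toFun g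
  map_add : ∀ f g : R, f ≠ 0 → g ≠ 0 → f + g ≠ 0 →
    le (toFun (f + g)) (toFun f) ∨ le (toFun (f + g)) (toFun g)
  map_smul : ∀ (c : k) (f : R), c ≠ 0 → f ≠ 0 → toFun (c • f) = toFun f
  fst_eq_degree : ∀ (m : ℕ) (f : R), f ∈ 𝒜 m → f ≠ 0 → (toFun f).1 = m

namespace HomogeneousValuation

variable {k R : Type*} [Field k] [CommRing R] [IsDomain R] [Algebra k R]
  {𝒜 : ℕ → Submodule k R} {r : ℕ}

/-- The value semigroup `S(R, ν) = {ν(f) : f ≠ 0}`. -/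
def valueSemigroup (ν : HomogeneousValuation k 𝒜 r) : AddSubmonoid (ℕ × (Fin r → ℤ)) where
  carrier := {s | ∃ f : R, f ≠ 0 ∧ ν.toFun f = s}
  zero_mem' := ⟨1, one_ne_zero, by
    have h := ν.map_mul 1 1 one_ne_zero one_ne_zero
    rw [mul_one] at h
    exact left_eq_add.mp h⟩
  add_mem' := by
    rintro _ _ ⟨f, hf, rfl⟩ ⟨g, hg, rfl⟩
    exact ⟨f * g, mul_ne_zero hf hg, ν.map_mul f g hf hg⟩

/-- The rank of `ν`: the rank of the subgroup of `ℤ × ℤ ^ r` generated by the value semigroup. -/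
def rank (ν : HomogeneousValuation k 𝒜 r) : ℕ :=
  Module.finrank ℤ (Submodule.span ℤ
    ((fun s : ℕ × (Fin r → ℤ) => ((s.1 : ℤ), s.2)) '' (ν.valueSemigroup : Set _)))

/-- The valuation has full rank if its rank is the Krull dimension of `R`. -/
def IsFullRank (ν : HomogeneousValuation k 𝒜 r) : Prop :=
  ringKrullDim R = (ν.rank : WithBot ℕ∞)

/-- The degree of an element of the value semigroup, i.e. its first component. -/
def degHom (ν : HomogeneousValuation k 𝒜 r) : ν.valueSemigroup →+ ℕ :=
  (AddMonoidHom.fst ℕ (Fin r → ℤ)).comp ν.valueSemigroup.subtype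

/-- The semigroup algebra `k[S]`. -/
abbrev semigroupAlgebra (ν : HomogeneousValuation k 𝒜 r) : Type _ :=
  AddMonoidAlgebra k ν.valueSemigroup

/-- The basis element `χ ^ s` of `k[S]`. -/
def character (ν : HomogeneousValuation k 𝒜 r) (s : ν.valueSemigroup) : ν.semigroupAlgebra :=
  AddMonoidAlgebra.single s 1

/-- The grading of `k[S]` by degree. -/
abbrev grading (ν : HomogeneousValuation k 𝒜 r) : ℕ → Submodule k ν.semigroupAlgebra :=
  AddMonoidAlgebra.gradeBy k ν.degHom

end HomogeneousValuation

/-! ### Initial ideals, the Gröbner fan and the tropicalization -/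

section Grobner

variable {k σ : Type*} [Field k] [Fintype σ]

open Classical in
/-- The initial form `in_w(f)`: the sum of the terms of `f` of minimal `w`-weight. -/
def initialForm (w : σ → ℝ) (f : MvPolynomial σ k) : MvPolynomial σ k :=
  ∑ α ∈ f.support with ∀ β ∈ f.support, ∑ i, w i * (α i : ℝ) ≤ ∑ i, w i * (β i : ℝ),
    MvPolynomial.monomial α (f.coeff α)

/-- The initial ideal `in_w(J)`, generated by the initial forms of all elements of `J`. -/
def initialIdeal (w : σ → ℝ) (J : Ideal (MvPolynomial σ k)) : Ideal (MvPolynomial σ k) :=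
  Ideal.span (initialForm w '' (J : Set (MvPolynomial σ k)))

/-- The (closed) Gröbner cone of `J` with `w` in its relative interior: the closure of the set of
all weights with the same initial ideal as `w`. -/
def grobnerCone (J : Ideal (MvPolynomial σ k)) (w : σ → ℝ) : Set (σ → ℝ) :=
  closure {w' | initialIdeal w' J = initialIdeal w J}

/-- The Gröbner fan `GF(J)`, as the set of its cones. -/
def grobnerFan (J : Ideal (MvPolynomial σ k)) : Set (Set (σ → ℝ)) :=
  Set.range (grobnerCone J)

/-- The tropicalization `𝒯(J)`: the weights whose initial ideal contains no monomial. -/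
def tropicalization (J : Ideal (MvPolynomial σ k)) : Set (σ → ℝ) :=
  {w | ∀ α : σ →₀ ℕ, MvPolynomial.monomial α (1 : k) ∉ initialIdeal w J}

/-- The tropicalization as a subfan of the Gröbner fan, given as the set of its cones. -/
def tropicalFan (J : Ideal (MvPolynomial σ k)) : Set (Set (σ → ℝ)) :=
  grobnerCone J '' tropicalization J

/-- The initial ideal `in_C(J)` of a cone `C` of the Gröbner fan: the common value of `in_w(J)`
for the weights `w` in the relative interior of `C`. -/
def initialIdealOfCone (J : Ideal (MvPolynomial σ k)) (C : Set (σ → ℝ)) :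
    Ideal (MvPolynomial σ k) :=
  ⨆ (w : σ → ℝ) (_ : grobnerCone J w = C), initialIdeal w J

/-- The exponents of the standard monomials of `in_C(J)`. -/
def standardExponents (J : Ideal (MvPolynomial σ k)) (C : Set (σ → ℝ)) : Set (σ →₀ ℕ) :=
  {α | MvPolynomial.monomial α (1 : k) ∉ initialIdealOfCone J C}

end Grobner

/-! ### Rational maps between `Proj`s induced by ring maps that multiply degrees -/

section InducedMaps

variable {k A B : Type u} [Field k] [CommRing A] [Algebra k A] [CommRing B] [Algebra k B]
  {𝒜 : ℕ → Submodule k A} {ℬ : ℕ → Submodule k B}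

/-- `s` sends homogeneous elements of degree `m` to homogeneous elements of degree `N * m`. -/
def MultipliesDegree (ℬ : ℕ → Submodule k B) (𝒜 : ℕ → Submodule k A)
    (s : B →ₐ[k] A) (N : ℕ) : Prop :=
  ∀ m, ∀ f ∈ ℬ m, s f ∈ 𝒜 (N * m)

theorem MultipliesDegree.mem {s : B →ₐ[k] A} {N : ℕ} (hs : MultipliesDegree ℬ 𝒜 s N)
    {m : ℕ} {f : B} (hf : f ∈ ℬ m) : s f ∈ 𝒜 (N * m) :=
  hs m f hf

variable [GradedAlgebra 𝒜] [GradedAlgebra ℬ]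

/-- The ring map `B_(f) → A_(s f)`, `g / f ^ n ↦ s g / (s f) ^ n`, on degree zero parts. -/
def awayMap {s : B →ₐ[k] A} {N : ℕ} (hs : MultipliesDegree ℬ 𝒜 s N) (f : B) :
    Away ℬ f →+* Away 𝒜 (s f) where
  toFun := Quotient.map'
    (fun x => ⟨N * x.deg, ⟨s x.num, hs.mem x.num.2⟩, ⟨s x.den, hs.mem x.den.2⟩, by
      obtain ⟨n, hn⟩ := x.den_mem
      exact ⟨n, by simp [← hn]⟩⟩)
    fun x y (e : x.embedding = y.embedding) => by
      have e' := congrArg (Localization.awayMap (s : B →+* A) f) e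
      simp only [NumDenSameDeg.embedding, Localization.awayMap, Localization.mk_eq_mk',
        IsLocalization.Away.map, IsLocalization.map_mk'] at e'
      change Localization.mk _ _ = Localization.mk _ _
      simp only [Localization.mk_eq_mk']
      exact e'
  map_add' := Quotient.ind₂' fun x y => by
    apply val_injective
    refine Eq.trans ?_ (val_add _ _).symm
    change Localization.mk (s ((x + y).num : B)) _ =
      Localization.mk (s x.num) ⟨s x.den, _⟩ + Localization.mk (s y.num) ⟨s y.den, _⟩
    rw [Localization.add_mk]
    congr 1
    · simp [NumDenSameDeg.num_add]
    · ext
      simp [NumDenSameDeg.den_add]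
  map_mul' := Quotient.ind₂' fun x y => by
    apply val_injective
    refine Eq.trans ?_ (val_mul _ _).symm
    change Localization.mk (s ((x * y).num : B)) _ =
      Localization.mk (s x.num) ⟨s x.den, _⟩ * Localization.mk (s y.num) ⟨s y.den, _⟩
    rw [Localization.mk_mul]
    congr 1
    · simp [NumDenSameDeg.num_mul]
    · ext
      simp [NumDenSameDeg.den_mul]
  map_zero' := by
    apply val_injective
    rw [val_zero]
    change Localization.mk (s ((0 : NumDenSameDeg ℬ (Submonoid.powers f)).num : B)) _ = 0
    simp [NumDenSameDeg.num_zero, Localization.mk_zero]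
  map_one' := by
    apply val_injective
    rw [val_one]
    change Localization.mk (s ((1 : NumDenSameDeg ℬ (Submonoid.powers f)).num : B))
      ⟨s ((1 : NumDenSameDeg ℬ (Submonoid.powers f)).den : B), _⟩ = 1
    simp only [NumDenSameDeg.num_one, NumDenSameDeg.den_one, map_one]
    exact Localization.mk_one

/-- The complement in `Proj A` of the vanishing locus of the ideal generated by `s(B₊)`. -/
def definednessLocus (ℬ : ℕ → Submodule k B) [GradedAlgebra ℬ] (𝒜 : ℕ → Submodule k A)
    [GradedAlgebra 𝒜] (s : B →ₐ[k] A) : (Proj 𝒜).Opens :=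
  ⟨(ProjectiveSpectrum.zeroLocus 𝒜 (s '' (HomogeneousIdeal.irrelevant ℬ : Set B)))ᶜ,
    (ProjectiveSpectrum.isClosed_zeroLocus 𝒜 _).isOpen_compl⟩

/-- A morphism `φ : U ⟶ Proj B` on an open subscheme `U` of `Proj A` on which it makes sense
(i.e. disjoint from the vanishing locus of `s(B₊)`) is induced by `s : B → A`, where `s`
multiplies degrees by `N > 0`, if for each homogeneous `f : B` of positive degree it is given on
`U ∩ D₊(s f)` by the ring map `B_(f) → A_(s f)`. This determines `φ`. -/
def IsInducedBy {s : B →ₐ[k] A} {N : ℕ} (hN : 0 < N) (hs : MultipliesDegree ℬ 𝒜 s N)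
    {U : (Proj 𝒜).Opens} (φ : (U : Scheme.{u}) ⟶ Proj ℬ) : Prop :=
  U ≤ definednessLocus ℬ 𝒜 s ∧
  ∀ (m : ℕ) (hm : 0 < m) (f : B) (hf : f ∈ ℬ m),
    Limits.pullback.fst U.ι (Proj.awayι 𝒜 (s f) (hs.mem hf) (Nat.mul_pos hN hm)) ≫ φ =
      Limits.pullback.snd U.ι (Proj.awayι 𝒜 (s f) (hs.mem hf) (Nat.mul_pos hN hm)) ≫
        Spec.map (CommRingCat.ofHom (awayMap hs f)) ≫ Proj.awayι ℬ f hf hm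

end InducedMaps
end ToricEmbedding
end

open ToricEmbedding

noncomputable section

namespace ToricEmbedding

/-! ### Full rank valuations and algebraically independent elements -/

namespace HomogeneousValuation

variable {k R : Type*} [Field k] [CommRing R] [Algebra k R]
  {𝒜 : ℕ → Submodule k R} {r : ℕ}

/-! The map `η` is built as a monomial map into a polynomial subring of `R`.

Elements with `ℤ`-independent values are algebraically independent, because their distinct monomials
have distinct values and cannot cancel. Full rank therefore gives transcendence degree at least `d +
1`, so some `d + 1` of the generators are algebraically independent
(`exists_algebraicIndependent_generators`).

Give these generators weight `0` and all others weight `-1`, and break ties generically. If the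
leading, i.e. minimal, monomial of some `f ∈ J` involved only the chosen variables, then no other
variable could occur in `f`, since it would make the weight negative. Such an `f` is an algebraic
relation among independent elements, which is impossible. So every monomial in the chosen generators
is standard. A small perturbation turns the refined order into a real weight whose initial ideal is
constant nearby, hence into a maximal Gröbner cone `C` (`exists_maximal_grobnerCone`).

It remains to embed `S` into `ℕ ^ (d + 1)` with weighted degree `N` times the degree
(`exists_weighted_embedding`). Take an integral linear map of weighted degree zero that is injective
on each degree, and make it nonnegative by adding a large multiple of the degree to all coordinates.
This is possible because `S` is finitely generated and `R_0 = k` leaves only `0` in degree zero. The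
embedding gives `θ`, and `η = ρ ∘ θ` is injective.

The geometric statement is formal: the ring maps glue on the charts `D₊(s f)`
(`exists_induced_factorization`), and density and dominance are tested at the generic point. -/

theorem map_neg (ν : HomogeneousValuation k 𝒜 r) {f : R} (hf : f ≠ 0) :
    ν.toFun (-f) = ν.toFun f := by
  simpa using ν.map_smul (-1) f (by simp) hf

theorem map_add_of_le (ν : HomogeneousValuation k 𝒜 r) {f g : R} (hf : f ≠ 0) (hg : g ≠ 0)
    (hfg : f + g ≠ 0) (hne : ν.toFun f ≠ ν.toFun g) (hle : ν.le (ν.toFun g) (ν.toFun f)) :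
    ν.toFun (f + g) = ν.toFun f := by
  apply ν.le_antisymm
  · rcases ν.map_add f g hf hg hfg with h | h
    · exact h
    · exact ν.le_trans _ _ _ h hle
  · have h := ν.map_add (f + g) (-g) hfg (neg_ne_zero.mpr hg) (by simpa using hf)
    rw [add_neg_cancel_right, ν.map_neg hg] at h
    exact h.resolve_right fun h ↦ hne (ν.le_antisymm _ _ h hle)

theorem add_ne_zero_of_ne (ν : HomogeneousValuation k 𝒜 r) {f g : R} (hf : f ≠ 0)
    (hne : ν.toFun f ≠ ν.toFun g) : f + g ≠ 0 := by
  intro h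
  rw [← neg_eq_of_add_eq_zero_right h, ν.map_neg hf] at hne
  exact hne rfl

theorem map_add_of_ne (ν : HomogeneousValuation k 𝒜 r) {f g : R} (hf : f ≠ 0) (hg : g ≠ 0)
    (hne : ν.toFun f ≠ ν.toFun g) :
    ν.toFun (f + g) = ν.toFun f ∨ ν.toFun (f + g) = ν.toFun g := by
  have hfg := ν.add_ne_zero_of_ne hf hne
  rcases ν.le_total (ν.toFun g) (ν.toFun f) with h | h
  · exact Or.inl (ν.map_add_of_le hf hg hfg hne h)
  · rw [add_comm] at hfg ⊢
    exact Or.inr (ν.map_add_of_le hg hf hfg hne.symm h)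

/-- A sum of nonzero elements with pairwise distinct values is nonzero, and its value is that of
one of the summands. -/
theorem exists_map_sum_eq (ν : HomogeneousValuation k 𝒜 r) {ι : Type*} (s : Finset ι)
    (hs : s.Nonempty) (f : ι → R) (hf : ∀ i ∈ s, f i ≠ 0)
    (hinj : Set.InjOn (fun i ↦ ν.toFun (f i)) s) :
    ∑ i ∈ s, f i ≠ 0 ∧ ∃ i ∈ s, ν.toFun (∑ i ∈ s, f i) = ν.toFun (f i) := by
  classical
  induction hs using Finset.Nonempty.cons_induction with
  | singleton a => exact ⟨by simpa using hf, a, by simp⟩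
  | cons a s ha hs ih =>
    obtain ⟨h0, i, hi, hν⟩ := ih (fun i hi ↦ hf i (Finset.mem_cons_of_mem hi))
      (hinj.mono fun i hi ↦ Finset.mem_coe.mpr (Finset.mem_cons_of_mem hi))
    have ha0 := hf a (Finset.mem_cons_self a s)
    have hne : ν.toFun (f a) ≠ ν.toFun (∑ i ∈ s, f i) := by
      rw [hν]
      intro h
      have := hinj (Finset.mem_coe.mpr (Finset.mem_cons_self a s))
        (Finset.mem_coe.mpr (Finset.mem_cons_of_mem hi)) h
      exact ha (this ▸ hi)
    rw [Finset.sum_cons]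
    refine ⟨ν.add_ne_zero_of_ne ha0 hne, ?_⟩
    rcases ν.map_add_of_ne ha0 h0 hne with h | h
    · exact ⟨a, Finset.mem_cons_self a s, h⟩
    · exact ⟨i, Finset.mem_cons_of_mem hi, h.trans hν⟩

variable [IsDomain R]

theorem map_one (ν : HomogeneousValuation k 𝒜 r) : ν.toFun 1 = 0 := by
  have h := ν.map_mul 1 1 one_ne_zero one_ne_zero
  rw [mul_one] at h
  exact left_eq_add.mp h

theorem map_pow (ν : HomogeneousValuation k 𝒜 r) {f : R} (hf : f ≠ 0) (n : ℕ) :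
    ν.toFun (f ^ n) = n • ν.toFun f := by
  induction n with
  | zero => simpa using ν.map_one
  | succ n ih => rw [pow_succ, ν.map_mul _ _ (pow_ne_zero n hf) hf, ih, succ_nsmul]

theorem map_prod (ν : HomogeneousValuation k 𝒜 r) {ι : Type*} (s : Finset ι) (f : ι → R)
    (hf : ∀ i ∈ s, f i ≠ 0) : ν.toFun (∏ i ∈ s, f i) = ∑ i ∈ s, ν.toFun (f i) := by
  classical
  induction s using Finset.induction_on with
  | empty => simpa using ν.map_one
  | insert a s ha ih =>
    have hs : ∀ i ∈ s, f i ≠ 0 := fun i hi ↦ hf i (Finset.mem_insert_of_mem hi)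
    rw [Finset.prod_insert ha, Finset.sum_insert ha,
      ν.map_mul _ _ (hf a (Finset.mem_insert_self a s)) (Finset.prod_ne_zero_iff.mpr hs), ih hs]

/-- Elements with linearly independent values are algebraically independent. -/
theorem algebraicIndependent_of_injective (ν : HomogeneousValuation k 𝒜 r) {ι : Type*} [Fintype ι]
    (f : ι → R) (hf : ∀ i, f i ≠ 0)
    (hinj : Function.Injective fun α : ι →₀ ℕ ↦ ∑ i, α i • ν.toFun (f i)) :
    AlgebraicIndependent k f := by
  rw [algebraicIndependent_iff]
  intro p hp
  by_contra hp0
  have hval : ∀ α ∈ p.support,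
      algebraMap k R (p.coeff α) * ∏ i, f i ^ α i ≠ 0 ∧
      ν.toFun (algebraMap k R (p.coeff α) * ∏ i, f i ^ α i) = ∑ i, α i • ν.toFun (f i) := by
    intro α hα
    have hc : p.coeff α ≠ 0 := MvPolynomial.mem_support_iff.mp hα
    have hprod : ∏ i, f i ^ α i ≠ 0 :=
      Finset.prod_ne_zero_iff.mpr fun i _ ↦ pow_ne_zero _ (hf i)
    rw [← Algebra.smul_def]
    refine ⟨smul_ne_zero hc hprod, ?_⟩
    rw [ν.map_smul _ _ hc hprod, ν.map_prod _ _ fun i _ ↦ pow_ne_zero _ (hf i)]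
    exact Finset.sum_congr rfl fun i _ ↦ ν.map_pow (hf i) _
  refine (ν.exists_map_sum_eq p.support (MvPolynomial.support_nonempty.mpr hp0) _
    (fun α hα ↦ (hval α hα).1) ?_).1 ?_
  · intro α hα β hβ h
    simp only [(hval α hα).2, (hval β hβ).2] at h
    exact hinj h
  · rw [MvPolynomial.aeval_def, MvPolynomial.eval₂_eq'] at hp
    exact hp

/-- A generating set of a free abelian group need not contain a basis, but a spanning set of a
vector space does. Hence the values are selected over `ℚ`, where the span has at least the same
rank, and independence is then restricted to `ℤ`. -/
theorem exists_linearIndependent_values (ν : HomogeneousValuation k 𝒜 r) :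
    ∃ f : Fin ν.rank → R, (∀ i, f i ≠ 0) ∧
      LinearIndependent ℤ fun i ↦ (((ν.toFun (f i)).1 : ℤ), (ν.toFun (f i)).2) := by
  let c : ℕ × (Fin r → ℤ) → ℤ × (Fin r → ℤ) := fun s ↦ (s.1, s.2)
  let T : Set (ℤ × (Fin r → ℤ)) := c '' (ν.valueSemigroup : Set _)
  let q : (ℤ × (Fin r → ℤ)) →ₗ[ℤ] (ℚ × (Fin r → ℚ)) :=
    (Algebra.linearMap ℤ ℚ).prodMap ((Algebra.linearMap ℤ ℚ).compLeft (Fin r))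
  have hq : Function.Injective q := by
    rintro ⟨a, v⟩ ⟨a', v'⟩ h
    have h1 := congrArg Prod.fst h
    have h2 := congrArg Prod.snd h
    refine Prod.ext (by simpa [q] using h1) (funext fun i ↦ ?_)
    simpa [q] using congrFun h2 i
  have hle : ν.rank ≤ Module.finrank ℚ (Submodule.span ℚ (q '' T)) := by
    obtain ⟨b, hb⟩ := exists_linearIndependent_of_le_finrank
      (R := ℤ) (M := Submodule.span ℤ T) (Nat.le_refl ν.rank)
    have hb' : LinearIndependent ℤ fun i ↦ q (b i : ℤ × (Fin r → ℤ)) :=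
      (hb.map' (Submodule.subtype _) (Submodule.ker_subtype _)).map' q (LinearMap.ker_eq_bot.mpr hq)
    rw [LinearIndependent.iff_fractionRing ℤ ℚ] at hb'
    have hmem : ∀ i, q (b i : ℤ × (Fin r → ℤ)) ∈ Submodule.span ℚ (q '' T) := by
      intro i
      have h1 : q (b i : ℤ × (Fin r → ℤ)) ∈ (Submodule.span ℤ T).map q :=
        Submodule.mem_map_of_mem (b i).2
      rw [Submodule.map_span] at h1
      exact Submodule.span_le_restrictScalars ℤ ℚ _ h1
    have hb'' : LinearIndependent ℚ fun i ↦
        (⟨q (b i : ℤ × (Fin r → ℤ)), hmem i⟩ : Submodule.span ℚ (q '' T)) :=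
      LinearIndependent.of_comp (Submodule.subtype _) hb'
    simpa using hb''.fintype_card_le_finrank
  obtain ⟨g, hg, -, hgi⟩ := Submodule.exists_fun_fin_finrank_span_eq ℚ (q '' T)
  have hg' : ∀ i, ∃ f : R, f ≠ 0 ∧ q (c (ν.toFun f)) = g i := by
    intro i
    obtain ⟨_, ⟨_, ⟨f, hf, rfl⟩, rfl⟩, h⟩ := hg i
    exact ⟨f, hf, h⟩
  choose f hf hfg using hg'
  refine ⟨fun i ↦ f (Fin.castLE hle i), fun i ↦ hf _, ?_⟩
  have h1 : LinearIndependent ℤ (g ∘ Fin.castLE hle) :=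
    (LinearIndependent.iff_fractionRing ℤ ℚ).mpr (hgi.comp _ (Fin.castLE_injective hle))
  have h2 : g ∘ Fin.castLE hle = q ∘ fun i ↦ c (ν.toFun (f (Fin.castLE hle i))) :=
    funext fun i ↦ (hfg _).symm
  rw [h2] at h1
  exact h1.of_comp q

theorem exists_algebraicIndependent (ν : HomogeneousValuation k 𝒜 r) :
    ∃ f : Fin ν.rank → R, AlgebraicIndependent k f := by
  obtain ⟨f, hf, hli⟩ := ν.exists_linearIndependent_values
  refine ⟨f, ν.algebraicIndependent_of_injective f hf fun α β h ↦ ?_⟩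
  rw [Fintype.linearIndependent_iff] at hli
  have h0 := hli (fun i ↦ (α i : ℤ) - β i) (by
    have h1 := congrArg Prod.fst h
    have h2 := congrArg Prod.snd h
    simp only [sub_smul, Finset.sum_sub_distrib, Prod.fst_sum, Prod.snd_sum, Prod.smul_fst,
      Prod.smul_snd] at h1 h2 ⊢
    rw [sub_eq_zero]
    refine Prod.ext ?_ ?_
    · simp only [Prod.fst_sum, Prod.smul_fst, smul_eq_mul] at h1 ⊢
      exact_mod_cast h1
    · simpa only [Prod.snd_sum, Prod.smul_snd, natCast_zsmul] using h2)
  ext i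
  have := h0 i
  omega

/-- Among generators of `R` there are `ν.rank` algebraically independent ones. -/
theorem exists_algebraicIndependent_generators (ν : HomogeneousValuation k 𝒜 r) {n d : ℕ}
    (hd : ν.rank = d) (b : Fin n → R) (hb : Algebra.adjoin k (Set.range b) = ⊤) :
    ∃ ι : Fin d ↪ Fin n, AlgebraicIndependent k fun j ↦ b (ι j) := by
  subst hd
  obtain ⟨f, hf⟩ := ν.exists_algebraicIndependent
  have : Algebra.IsAlgebraic (Algebra.adjoin k (Set.range b)) R := by
    rw [hb]
    exact ⟨fun x ↦ isAlgebraic_algebraMap (⟨x, trivial⟩ : (⊤ : Subalgebra k R))⟩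
  -- A generating set contains a transcendence basis, whose size bounds that of every algebraically
  -- independent family.
  obtain ⟨t, htb, ht⟩ := exists_isTranscendenceBasis_subset (R := k) (Set.range b)
  have htfin : Finite t := (Set.finite_range b).subset htb
  have := Fintype.ofFinite t
  have hle : Fintype.card (Fin ν.rank) ≤ Fintype.card t := by
    have h1 := hf.lift_cardinalMk_le_trdeg
    rw [ht.cardinalMk_eq_trdeg.symm] at h1
    simpa [Cardinal.mk_fintype] using h1
  obtain ⟨g⟩ := Function.Embedding.nonempty_of_card_le hle
  have hex : ∀ j, ∃ i, b i = (g j : R) := fun j ↦ htb (g j).2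
  choose ι hι using hex
  refine ⟨⟨ι, fun i j h ↦ g.injective (Subtype.ext ?_)⟩, ?_⟩
  · rw [← hι i, ← hι j, h]
  · have := ht.1.comp g g.injective
    rwa [show Subtype.val ∘ g = fun j ↦ b (ι j) from funext fun j ↦ (hι j).symm] at this

end HomogeneousValuation

/-! ### Embedding the value semigroup into a free commutative monoid -/

section Semigroup

variable {r : ℕ}

/-- The inclusion `ℕ × ℤ ^ r → ℤ × ℤ ^ r`. -/
def castHom (r : ℕ) : ℕ × (Fin r → ℤ) →+ ℤ × (Fin r → ℤ) where
  toFun s := (s.1, s.2)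
  map_zero' := by simp
  map_add' s t := by simp

theorem castHom_injective : Function.Injective (castHom r) := by
  rintro ⟨a, v⟩ ⟨b, w⟩ h
  simpa [castHom] using h

/-- On a subgroup of rank `d + 1` of `ℤ × ℤ ^ r` on which the first coordinate does not vanish,
there are `d` linear forms that together with the first coordinate separate points. -/
theorem exists_separating_forms (G : Submodule ℤ (ℤ × (Fin r → ℤ))) {d : ℕ}
    (hG : Module.finrank ℤ G = d + 1) {g₀ : G} (hg₀ : (g₀ : ℤ × (Fin r → ℤ)).1 ≠ 0) :
    ∃ l : G →ₗ[ℤ] (Fin d → ℤ), ∀ g : G, (g : ℤ × (Fin r → ℤ)).1 = 0 → l g = 0 → g = 0 := by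
  let deg : G →ₗ[ℤ] ℤ := (LinearMap.fst ℤ ℤ (Fin r → ℤ)).comp G.subtype
  have hdeg : ∀ g : G, deg g = (g : ℤ × (Fin r → ℤ)).1 := fun g ↦ rfl
  have hrange : Module.finrank ℤ (LinearMap.range deg) = 1 := by
    apply le_antisymm
    · exact (Submodule.finrank_le _).trans_eq (Module.finrank_self ℤ)
    · rw [Nat.one_le_iff_ne_zero, Ne, Submodule.finrank_eq_zero]
      intro h
      exact hg₀ ((Submodule.mem_bot ℤ).mp (h ▸ LinearMap.mem_range_self deg g₀))
  have hker : Module.finrank ℤ (LinearMap.ker deg) = d := by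
    have h1 := Submodule.finrank_quotient_add_finrank (LinearMap.ker deg)
    rw [(LinearMap.quotKerEquivRange deg).finrank_eq, hrange, hG] at h1
    omega
  let e := (Module.finBasisOfFinrankEq ℤ (LinearMap.ker deg) hker).equivFun
  -- Up to the factor `deg g₀`, this is the projection onto `ker deg` along `g₀`; it avoids
  -- denominators. On `ker deg` it is multiplication by `deg g₀ ≠ 0`.
  let p : G →ₗ[ℤ] G := deg g₀ • LinearMap.id - deg.smulRight g₀
  have hp : ∀ g, p g ∈ LinearMap.ker deg := by
    intro g
    simp [p, mul_comm]
  refine ⟨e.toLinearMap.comp (p.codRestrict _ hp), fun g hg hl ↦ ?_⟩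
  have h1 : p.codRestrict _ hp g = 0 := by simpa using hl
  have h2 : p g = 0 := congrArg Subtype.val h1
  have h3 : deg g₀ • g = 0 := by
    simpa [p, hdeg g, hg] using h2
  exact (smul_eq_zero.mp h3).resolve_left hg₀

/-- A finitely generated submonoid `S` of `ℕ × ℤ ^ r` of rank `d + 1` with only trivial elements in
degree zero embeds into `ℕ ^ (d + 1)`, in such a way that the degree is multiplied by a constant
with respect to given positive weights on `ℕ ^ (d + 1)`. -/
theorem exists_weighted_embedding (S : AddSubmonoid (ℕ × (Fin r → ℤ))) (hfg : S.FG)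
    (h0 : ∀ s ∈ S, s.1 = 0 → s = 0) {d : ℕ}
    (hrank : Module.finrank ℤ (Submodule.span ℤ (castHom r '' (S : Set _))) = d + 1)
    (e : Fin (d + 1) → ℕ) (he : ∀ i, 0 < e i) :
    ∃ (A : S →+ (Fin (d + 1) →₀ ℕ)) (N : ℕ), 0 < N ∧ Function.Injective A ∧
      ∀ s, Finsupp.weight e (A s) = N * (s : ℕ × (Fin r → ℤ)).1 := by
  let c : S → Submodule.span ℤ (castHom r '' (S : Set _)) :=
    fun s ↦ ⟨castHom r s, Submodule.subset_span ⟨s, s.2, rfl⟩⟩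
  have hc_add : ∀ s t, c (s + t) = c s + c t := fun s t ↦ Subtype.ext (map_add (castHom r) _ _)
  have hc_zero : c 0 = 0 := Subtype.ext (map_zero (castHom r))
  obtain ⟨s₀, hs₀⟩ : ∃ s : S, (s : ℕ × (Fin r → ℤ)).1 ≠ 0 := by
    by_contra! h
    have hbot : Submodule.span ℤ (castHom r '' (S : Set _)) = ⊥ := by
      rw [Submodule.span_eq_bot]
      rintro _ ⟨s, hs, rfl⟩
      rw [h0 s hs (h ⟨s, hs⟩), map_zero]
    rw [hbot, finrank_bot] at hrank
    omega
  obtain ⟨l, hl⟩ := exists_separating_forms _ hrank (g₀ := c s₀)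
    (by simpa [c, castHom] using hs₀)
  -- The zeroth coordinate balances the others so that `∑ e i * B s i = 0`; the factor `e 0` on the
  -- others keeps everything integral.
  let B : S → Fin (d + 1) → ℤ := fun s ↦
    Fin.cons (-∑ j : Fin d, e j.succ * l (c s) j) (fun j ↦ e 0 * l (c s) j)
  have hB_add : ∀ s t i, B (s + t) i = B s i + B t i := by
    intro s t i
    refine Fin.cases ?_ (fun j ↦ ?_) i
    · simp only [B, Fin.cons_zero, hc_add, map_add, Pi.add_apply, mul_add, Finset.sum_add_distrib,
        neg_add]
    · simp only [B, Fin.cons_succ, hc_add, map_add, Pi.add_apply, mul_add]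
  have hB_zero : ∀ i, B 0 i = 0 := by
    intro i
    refine Fin.cases ?_ (fun j ↦ ?_) i <;> simp [B, hc_zero]
  have hB_sum : ∀ s, ∑ i, (e i : ℤ) * B s i = 0 := by
    intro s
    simp only [B, Fin.sum_univ_succ, Fin.cons_zero, Fin.cons_succ, mul_neg, Finset.mul_sum]
    rw [neg_add_eq_zero]
    exact Finset.sum_congr rfl fun j _ ↦ by ring
  obtain ⟨T, hT⟩ := hfg
  -- A generator of positive degree gains at least `M` in each coordinate, enough to absorb its
  -- negative entries. A generator of degree zero is `0`, where `B` vanishes.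
  obtain ⟨M, hM, hMB⟩ : ∃ M : ℕ, 0 < M ∧
      ∀ s : S, (s : ℕ × (Fin r → ℤ)) ∈ T → ∀ i, -(M : ℤ) ≤ B s i := by
    have hfin : (Set.range fun p : {s : S // (s : ℕ × (Fin r → ℤ)) ∈ T} × Fin (d + 1) ↦
        (B p.1 p.2).natAbs).Finite := by
      have : Finite {s : S // (s : ℕ × (Fin r → ℤ)) ∈ T} :=
        Finite.of_injective (β := T) (fun s ↦ ⟨s.1, s.2⟩)
          fun s t h ↦ Subtype.ext (Subtype.ext (Subtype.mk.inj h))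
      exact Set.finite_range _
    obtain ⟨M, hM⟩ := hfin.bddAbove
    refine ⟨M + 1, by omega, fun s hs i ↦ ?_⟩
    have := hM ⟨(⟨s, hs⟩, i), rfl⟩
    simp only at this
    omega
  have hnonneg : ∀ s : S, ∀ i, 0 ≤ M * ((s : ℕ × (Fin r → ℤ)).1 : ℤ) + B s i := by
    rintro ⟨s, hs⟩
    have hs' := hs
    rw [← hT] at hs'
    induction hs' using AddSubmonoid.closure_induction with
    | mem x hx =>
      intro i
      rcases Nat.eq_zero_or_pos x.1 with h | h
      · have hx0 : (⟨x, hs⟩ : S) = 0 := Subtype.ext (h0 x hs h)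
        rw [hx0, hB_zero]
        simp
      · have h1 := hMB ⟨x, hs⟩ hx i
        have h2 : (M : ℤ) * 1 ≤ M * (x.1 : ℤ) := by gcongr; exact_mod_cast h
        simp only
        omega
    | zero =>
      intro i
      have h1 := hB_zero i
      change 0 ≤ M * ((0 : ℕ) : ℤ) + B 0 i
      simp [h1]
    | add x y hx hy ihx ihy =>
      intro i
      rw [hT] at hx hy
      have h1 := ihx hx i
      have h2 := ihy hy i
      have h3 := hB_add ⟨x, hx⟩ ⟨y, hy⟩ i
      rw [show (⟨x + y, hs⟩ : S) = ⟨x, hx⟩ + ⟨y, hy⟩ from rfl, h3]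
      simp only [AddSubmonoid.coe_add, Prod.fst_add, Nat.cast_add, mul_add] at h1 h2 ⊢
      omega
  let A : S →+ (Fin (d + 1) →₀ ℕ) :=
    { toFun := fun s ↦ Finsupp.equivFunOnFinite.symm fun i ↦
        (M * ((s : ℕ × (Fin r → ℤ)).1 : ℤ) + B s i).toNat
      map_zero' := by
        ext i
        simp [hB_zero]
      map_add' := fun s t ↦ by
        ext i
        rw [Finsupp.add_apply]
        simp only [Finsupp.equivFunOnFinite_symm_apply_apply]
        rw [← Int.toNat_add (hnonneg s i) (hnonneg t i), hB_add]
        simp only [AddSubmonoid.coe_add, Prod.fst_add, Nat.cast_add]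
        congr 1
        ring }
  have hA : ∀ s i, ((A s i : ℕ) : ℤ) = M * ((s : ℕ × (Fin r → ℤ)).1 : ℤ) + B s i :=
    fun s i ↦ Int.toNat_of_nonneg (hnonneg s i)
  -- The part `B` has weight zero, so only the diagonal shift by `M * deg s` contributes.
  have hweight : ∀ s, Finsupp.weight e (A s) = M * (∑ i, e i) * (s : ℕ × (Fin r → ℤ)).1 := by
    intro s
    rw [Finsupp.weight_apply, Finsupp.sum_fintype _ _ (by simp)]
    zify
    simp only [smul_eq_mul, Nat.cast_mul, hA, add_mul, Finset.sum_add_distrib]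
    rw [← Finset.mul_sum]
    have := hB_sum s
    simp only [mul_comm (e _ : ℤ)] at this
    rw [this]
    ring
  have hN : 0 < M * ∑ i, e i :=
    Nat.mul_pos hM (Finset.sum_pos (fun i _ ↦ he i) Finset.univ_nonempty)
  refine ⟨A, M * ∑ i, e i, hN, fun s t hst ↦ ?_, hweight⟩
  -- Injectivity: the weight recovers the degree, subtracting the shift recovers `B`, and dividing
  -- by `e 0` recovers the separating forms.
  have hfst : (s : ℕ × (Fin r → ℤ)).1 = (t : ℕ × (Fin r → ℤ)).1 := by
    have := hweight s
    rw [hst, hweight t] at this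
    exact (Nat.eq_of_mul_eq_mul_left hN this).symm
  have hB : ∀ i, B s i = B t i := by
    intro i
    have h1 := hA s i
    rw [hst, hA t i, hfst] at h1
    omega
  have hlc : l (c s) = l (c t) := by
    funext j
    have := hB j.succ
    simp only [B, Fin.cons_succ] at this
    exact mul_left_cancel₀ (by exact_mod_cast (he 0).ne') this
  have hsub := hl (c s - c t) (sub_eq_zero.mpr (congrArg (Nat.cast : ℕ → ℤ) hfst))
    (by rw [map_sub, hlc, sub_self])
  have hcst : castHom r s = castHom r t := congrArg Subtype.val (sub_eq_zero.mp hsub)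
  exact Subtype.ext (castHom_injective hcst)

end Semigroup

/-! ### Initial ideals for generic weights -/

section InitialIdeals

open MvPolynomial

variable {k σ : Type*} [Field k] [Fintype σ]

/-- The weight of a monomial. -/
def realWeight (w : σ → ℝ) : (σ →₀ ℕ) →+ ℝ where
  toFun α := ∑ i, w i * (α i : ℝ)
  map_zero' := by simp
  map_add' α β := by simp [mul_add, Finset.sum_add_distrib]

theorem realWeight_apply (w : σ → ℝ) (α : σ →₀ ℕ) : realWeight w α = ∑ i, w i * (α i : ℝ) := rfl

theorem coeff_initialForm (w : σ → ℝ) (f : MvPolynomial σ k) (β : σ →₀ ℕ) [Decidable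
    (β ∈ f.support ∧ ∀ γ ∈ f.support, realWeight w β ≤ realWeight w γ)] :
    (initialForm w f).coeff β =
      if β ∈ f.support ∧ ∀ γ ∈ f.support, realWeight w β ≤ realWeight w γ then f.coeff β else 0 := by
  classical
  rw [initialForm, coeff_sum]
  simp only [coeff_monomial]
  rw [Finset.sum_ite_eq']
  simp only [Finset.mem_filter]
  exact if_congr Iff.rfl rfl rfl

/-! ### Leading exponents and standard monomials for a fixed order on monomials. -/

section Lead

variable {Γ : Type*} [AddCommMonoid Γ] [LinearOrder Γ]

/-- The exponents of the leading (i.e. `φ`-minimal) terms of the nonzero weighted homogeneous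
elements of `J`. -/
def leadExponents (φ : (σ →₀ ℕ) →+ Γ) (e : σ → ℕ) (J : Ideal (MvPolynomial σ k)) :
    Set (σ →₀ ℕ) :=
  {α | ∃ f ∈ J, IsWeightedHomogeneous e f (Finsupp.weight e α) ∧ f.coeff α = 1 ∧
    ∀ β ∈ f.support, β ≠ α → φ α < φ β}

variable {φ : (σ →₀ ℕ) →+ Γ} {e : σ → ℕ} {J : Ideal (MvPolynomial σ k)}

omit [Fintype σ] in
theorem mem_support_monomial_mul {γ β : σ →₀ ℕ} {f : MvPolynomial σ k}
    (h : β ∈ (monomial γ 1 * f).support) : ∃ β' ∈ f.support, β = γ + β' := by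
  classical
  rw [mem_support_iff, coeff_monomial_mul'] at h
  split_ifs at h with hγ
  · refine ⟨β - γ, mem_support_iff.mpr fun h0 ↦ h (by rw [h0, mul_zero]), ?_⟩
    exact (add_tsub_cancel_of_le hγ).symm
  · exact absurd rfl h

omit [Fintype σ] in
theorem add_mem_leadExponents [IsOrderedCancelAddMonoid Γ] {α : σ →₀ ℕ}
    (hα : α ∈ leadExponents φ e J) (γ : σ →₀ ℕ) :
    γ + α ∈ leadExponents φ e J := by
  obtain ⟨f, hf, hhom, hc, hlt⟩ := hα
  refine ⟨monomial γ 1 * f, J.mul_mem_left _ hf, ?_, by rw [coeff_monomial_mul, one_mul, hc], ?_⟩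
  · rw [map_add]
    exact (isWeightedHomogeneous_monomial e γ 1 rfl).mul hhom
  · intro β hβ hne
    obtain ⟨β', hβ', rfl⟩ := mem_support_monomial_mul hβ
    rw [map_add, map_add]
    exact add_lt_add_right (hlt β' hβ' fun h ↦ hne (h ▸ rfl)) _

omit [Fintype σ] in
theorem mem_leadExponents_of_le [IsOrderedCancelAddMonoid Γ] {α β : σ →₀ ℕ}
    (hα : α ∈ leadExponents φ e J) (h : α ≤ β) :
    β ∈ leadExponents φ e J := by
  obtain ⟨γ, rfl⟩ := exists_add_of_le h
  rw [add_comm]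
  exact add_mem_leadExponents hα γ

omit [Fintype σ] in
theorem monomial_mem_span_leadExponents_iff [IsOrderedCancelAddMonoid Γ] (α : σ →₀ ℕ) :
    monomial α (1 : k) ∈ Ideal.span ((fun s ↦ monomial s (1 : k)) '' leadExponents φ e J) ↔
      α ∈ leadExponents φ e J := by
  classical
  rw [mem_ideal_span_monomial_image]
  constructor
  · intro h
    obtain ⟨β, hβ, hle⟩ := h α (by simp)
    exact mem_leadExponents_of_le hβ hle
  · intro h β hβ
    have : β = α := by simpa [mem_support_iff, coeff_monomial, eq_comm] using hβ
    exact ⟨α, h, this.ge⟩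

omit [Fintype σ] in
/-- A nonzero element of a weighted homogeneous ideal involves a leading monomial. -/
theorem exists_mem_support_mem_leadExponents (hφ : Function.Injective φ)
    (hJ : ∀ f ∈ J, ∀ m, weightedHomogeneousComponent e m f ∈ J) {f : MvPolynomial σ k} (hf : f ∈ J)
    (hf0 : f ≠ 0) : ∃ α ∈ f.support, α ∈ leadExponents φ e J := by
  classical
  obtain ⟨α, hα, hmin⟩ := Finset.exists_min_image f.support φ (support_nonempty.mpr hf0)
  have hc : f.coeff α ≠ 0 := mem_support_iff.mp hα
  -- The witness is the homogeneous component of `f` through its minimal exponent, normalised; its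
  -- other terms are terms of `f`, so they stay larger.
  refine ⟨α, hα, C (f.coeff α)⁻¹ * weightedHomogeneousComponent e (Finsupp.weight e α) f,
    J.mul_mem_left _ (hJ f hf _), ?_, ?_, ?_⟩
  · have := (isWeightedHomogeneous_C e (f.coeff α)⁻¹).mul
      (weightedHomogeneousComponent_isWeightedHomogeneous (w := e) (Finsupp.weight e α) f)
    rwa [zero_add] at this
  · rw [coeff_C_mul, coeff_weightedHomogeneousComponent, if_pos rfl, inv_mul_cancel₀ hc]
  · intro β hβ hne
    have hβf : β ∈ f.support := by
      rw [mem_support_iff, coeff_C_mul, coeff_weightedHomogeneousComponent] at hβ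
      rw [mem_support_iff]
      intro h0
      exact hβ (by simp [h0])
    exact lt_of_le_of_ne (hmin β hβf) fun h ↦ hne (hφ h).symm

/-- Dickson's lemma, obtained from Hilbert's basis theorem: finitely many of the monomials already
generate the monomial ideal they span. -/
theorem exists_finset_leadExponents (φ : (σ →₀ ℕ) →+ Γ) (e : σ → ℕ)
    (J : Ideal (MvPolynomial σ k)) :
    ∃ F : Finset (σ →₀ ℕ), ↑F ⊆ leadExponents φ e J ∧
      ∀ α ∈ leadExponents φ e J, ∃ m ∈ F, m ≤ α := by
  classical
  obtain ⟨s, hs, hspan⟩ := (Submodule.fg_span_iff_fg_span_finset_subset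
    ((fun s ↦ monomial s (1 : k)) '' leadExponents φ e J)).mp
    (IsNoetherian.noetherian (R := MvPolynomial σ k) (Submodule.span _ _))
  obtain ⟨F, hF, rfl⟩ := Finset.subset_set_image_iff.mp hs
  refine ⟨F, hF, fun α hα ↦ ?_⟩
  have h1 : monomial α (1 : k) ∈
      Ideal.span ((fun s ↦ monomial s (1 : k)) '' (F : Set (σ →₀ ℕ))) := by
    rw [← Finset.coe_image, Ideal.span, ← hspan]
    exact Submodule.subset_span ⟨α, hα, rfl⟩
  exact mem_ideal_span_monomial_image.mp h1 α (by simp)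

/-- `g` is a family of elements of `J`, indexed by the exponents in a generating set of
`leadExponents φ e J`, with the corresponding leading terms. -/
structure IsLeadBasis (φ : (σ →₀ ℕ) →+ Γ) (e : σ → ℕ) (J : Ideal (MvPolynomial σ k))
    (F : Finset (σ →₀ ℕ)) (g : (σ →₀ ℕ) → MvPolynomial σ k) : Prop where
  exists_le : ∀ α ∈ leadExponents φ e J, ∃ m ∈ F, m ≤ α
  mem : ∀ m ∈ F, g m ∈ J
  isWeightedHomogeneous : ∀ m ∈ F, IsWeightedHomogeneous e (g m) (Finsupp.weight e m)
  coeff_eq_one : ∀ m ∈ F, (g m).coeff m = 1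
  lt : ∀ m ∈ F, ∀ β ∈ (g m).support, β ≠ m → φ m < φ β

theorem exists_isLeadBasis (φ : (σ →₀ ℕ) →+ Γ) (e : σ → ℕ) (J : Ideal (MvPolynomial σ k)) :
    ∃ F g, IsLeadBasis φ e J F g := by
  obtain ⟨F, hF, hle⟩ := exists_finset_leadExponents φ e J
  have hex : ∀ m ∈ F, ∃ f ∈ J, IsWeightedHomogeneous e f (Finsupp.weight e m) ∧ f.coeff m = 1 ∧
      ∀ β ∈ f.support, β ≠ m → φ m < φ β := fun m hm ↦ hF hm
  choose! g hg using hex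
  exact ⟨F, g, hle, fun m hm ↦ (hg m hm).1, fun m hm ↦ (hg m hm).2.1, fun m hm ↦ (hg m hm).2.2.1,
    fun m hm ↦ (hg m hm).2.2.2⟩

/-- The weights for which the members of a family of polynomials have given leading exponents. -/
def compatibleWeights (F : Finset (σ →₀ ℕ)) (g : (σ →₀ ℕ) → MvPolynomial σ k) : Set (σ → ℝ) :=
  {w | ∀ m ∈ F, ∀ β ∈ (g m).support, β ≠ m → realWeight w m < realWeight w β}

theorem isOpen_compatibleWeights (F : Finset (σ →₀ ℕ)) (g : (σ →₀ ℕ) → MvPolynomial σ k) :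
    IsOpen (compatibleWeights F g) := by
  have : compatibleWeights F g = ⋂ m ∈ F, ⋂ β ∈ (g m).support, ⋂ (_ : β ≠ m),
      {w | realWeight w m < realWeight w β} := by
    ext w
    simp [compatibleWeights]
  rw [this]
  refine isOpen_biInter_finset fun m _ ↦ isOpen_biInter_finset fun β _ ↦
    isOpen_iInter_of_finite fun _ ↦ ?_
  simp only [realWeight_apply]
  exact isOpen_lt (by fun_prop) (by fun_prop)

variable {F : Finset (σ →₀ ℕ)} {g : (σ →₀ ℕ) → MvPolynomial σ k}

/-- Modulo `J`, a leading monomial is a combination of standard monomials of larger weight. -/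
theorem IsLeadBasis.monomial_mem_sup (h : IsLeadBasis φ e J F g) (he : ∀ i, 0 < e i)
    {w : σ → ℝ} (hw : w ∈ compatibleWeights F g) (α : σ →₀ ℕ) (hα : α ∈ leadExponents φ e J) :
    monomial α (1 : k) ∈ J.restrictScalars k ⊔
      restrictSupport k {β | β ∉ leadExponents φ e J ∧ realWeight w α < realWeight w β} := by
  classical
  -- The weight `w` need not be a well-order on monomials. Termination comes from positivity of `e`:
  -- reduction preserves the `e`-degree, and each degree has finitely many monomials. The induction
  -- is on how many of them are heavier than `α`.
  have hfin : ∀ α : σ →₀ ℕ, {β : σ →₀ ℕ | Finsupp.weight e β = Finsupp.weight e α ∧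
      realWeight w α < realWeight w β}.Finite := fun α ↦
    (Finsupp.finite_of_nat_weight_le e (fun i ↦ (he i).ne') (Finsupp.weight e α)).subset
      fun β hβ ↦ hβ.1.le
  induction hn : {β : σ →₀ ℕ | Finsupp.weight e β = Finsupp.weight e α ∧
      realWeight w α < realWeight w β}.ncard using Nat.strong_induction_on generalizing α with
  | _ n ih =>
  obtain ⟨m, hm, hle⟩ := h.exists_le α hα
  obtain ⟨γ, rfl⟩ := exists_add_of_le hle
  rw [add_comm m γ] at *
  have hp : monomial γ (1 : k) * g m ∈ J := J.mul_mem_left _ (h.mem m hm)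
  have key : ∀ β ∈ (monomial γ (1 : k) * g m).support, β ≠ γ + m → monomial β (1 : k) ∈
      J.restrictScalars k ⊔ restrictSupport k
        {β | β ∉ leadExponents φ e J ∧ realWeight w (γ + m) < realWeight w β} := by
    intro β hβ hne
    obtain ⟨β', hβ', rfl⟩ := mem_support_monomial_mul hβ
    have hlt : realWeight w (γ + m) < realWeight w (γ + β') := by
      rw [map_add, map_add]
      exact add_lt_add_right (hw m hm β' hβ' fun h ↦ hne (h ▸ rfl)) _
    by_cases hβL : γ + β' ∈ leadExponents φ e J
    · have hdeg : Finsupp.weight e (γ + β') = Finsupp.weight e (γ + m) := by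
        rw [map_add, map_add, h.isWeightedHomogeneous m hm (mem_support_iff.mp hβ')]
      have hlt' : {β : σ →₀ ℕ | Finsupp.weight e β = Finsupp.weight e (γ + β') ∧
          realWeight w (γ + β') < realWeight w β}.ncard < n := by
        rw [← hn]
        refine Set.ncard_lt_ncard ?_ (hfin _)
        refine ⟨fun β hβ ↦ ⟨hβ.1.trans hdeg, hlt.trans hβ.2⟩, fun hsub ↦ ?_⟩
        exact lt_irrefl _ (hsub ⟨hdeg, hlt⟩).2
      have hsub : {β | β ∉ leadExponents φ e J ∧ realWeight w (γ + β') < realWeight w β} ⊆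
          {β | β ∉ leadExponents φ e J ∧ realWeight w (γ + m) < realWeight w β} :=
        fun β hβ ↦ ⟨hβ.1, hlt.trans hβ.2⟩
      exact sup_le_sup_left (restrictSupport_mono k hsub) _ (ih _ hlt' _ hβL rfl)
    · exact Submodule.mem_sup_right ((monomial_mem_restrictSupport k).mpr (Or.inl ⟨hβL, hlt⟩))
  have hsum : monomial (γ + m) (1 : k) = monomial γ (1 : k) * g m -
      ∑ β ∈ (monomial γ (1 : k) * g m).support.erase (γ + m),
        (monomial γ (1 : k) * g m).coeff β • monomial β (1 : k) := by
    have hmem : γ + m ∈ (monomial γ (1 : k) * g m).support := by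
      rw [mem_support_iff, coeff_monomial_mul, h.coeff_eq_one m hm]
      simp
    have h1 := support_sum_monomial_coeff (monomial γ (1 : k) * g m)
    rw [← Finset.add_sum_erase _ _ hmem, coeff_monomial_mul, h.coeff_eq_one m hm, one_mul] at h1
    rw [eq_sub_iff_add_eq]
    convert h1 using 3
    rw [smul_monomial, smul_eq_mul, mul_one]
  rw [hsum]
  refine Submodule.sub_mem _ (Submodule.mem_sup_left hp) (Submodule.sum_mem _ fun β hβ ↦ ?_)
  rw [Finset.mem_erase] at hβ
  exact Submodule.smul_mem _ _ (key β hβ.2 hβ.1)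

/-- The standard monomials span modulo `J`. -/
theorem IsLeadBasis.sup_restrictSupport_eq_top (h : IsLeadBasis φ e J F g) (he : ∀ i, 0 < e i)
    {w : σ → ℝ} (hw : w ∈ compatibleWeights F g) :
    J.restrictScalars k ⊔ restrictSupport k (leadExponents φ e J)ᶜ = ⊤ := by
  rw [eq_top_iff]
  rintro f -
  rw [← support_sum_monomial_coeff f]
  refine Submodule.sum_mem _ fun α _ ↦ ?_
  rw [← mul_one (coeff α f), ← smul_eq_mul, ← smul_monomial]
  refine Submodule.smul_mem _ _ ?_
  by_cases hα : α ∈ leadExponents φ e J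
  · exact sup_le_sup_left (restrictSupport_mono k fun β hβ ↦ hβ.1) _ (h.monomial_mem_sup he hw α hα)
  · exact Submodule.mem_sup_right ((monomial_mem_restrictSupport k).mpr (Or.inl hα))

omit [Fintype σ] in
/-- The standard monomials are linearly independent modulo `J`. -/
theorem eq_zero_of_mem_restrictSupport (hφ : Function.Injective φ)
    (hJ : ∀ f ∈ J, ∀ m, weightedHomogeneousComponent e m f ∈ J) {f : MvPolynomial σ k} (hf : f ∈ J)
    (hs : f ∈ restrictSupport k (leadExponents φ e J)ᶜ) : f = 0 := by
  by_contra hf0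
  obtain ⟨α, hα, hαL⟩ := exists_mem_support_mem_leadExponents hφ hJ hf hf0
  exact (mem_restrictSupport_iff k).mp hs hα hαL

/-- The right-hand side does not mention `w`, so the initial ideal is constant on the open set
`compatibleWeights F g`. One inclusion holds because `g m` has initial form `monomial m 1`. For the
other, a standard exponent `β` in an initial form would give a nonzero element of `J` supported on
standard monomials. -/
theorem IsLeadBasis.initialIdeal_eq (h : IsLeadBasis φ e J F g) (he : ∀ i, 0 < e i)
    (hφ : Function.Injective φ) (hJ : ∀ f ∈ J, ∀ m, weightedHomogeneousComponent e m f ∈ J)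
    {w : σ → ℝ} (hw : w ∈ compatibleWeights F g) :
    initialIdeal w J = Ideal.span ((fun s ↦ monomial s (1 : k)) '' leadExponents φ e J) := by
  classical
  apply le_antisymm
  · rw [initialIdeal, Ideal.span_le]
    rintro _ ⟨f, hf, rfl⟩
    change _ ∈ Ideal.span _
    rw [mem_ideal_span_monomial_image]
    intro β hβ
    rw [mem_support_iff, coeff_initialForm] at hβ
    split_ifs at hβ with hcond
    swap
    · exact absurd rfl hβ
    obtain ⟨hβf, hmin⟩ := hcond
    refine ⟨β, ?_, le_rfl⟩
    by_contra hβL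
    -- Reducing the remaining terms of `f` cannot produce `β`: each reduction only creates weights
    -- above that of `α`, which is at least that of `β`.
    have hother : ∀ α ∈ f.support.erase β, monomial α (f.coeff α) ∈ J.restrictScalars k ⊔
        restrictSupport k ((leadExponents φ e J)ᶜ \ {β}) := by
      intro α hα
      rw [Finset.mem_erase] at hα
      rw [← mul_one (coeff α f), ← smul_eq_mul, ← smul_monomial]
      refine Submodule.smul_mem _ _ ?_
      by_cases hαL : α ∈ leadExponents φ e J
      · have hsub : {γ | γ ∉ leadExponents φ e J ∧ realWeight w α < realWeight w γ} ⊆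
            (leadExponents φ e J)ᶜ \ {β} := by
          refine fun γ hγ ↦ ⟨hγ.1, ?_⟩
          rintro rfl
          exact absurd hγ.2 (hmin α hα.2).not_gt
        exact sup_le_sup_left (restrictSupport_mono k hsub) _ (h.monomial_mem_sup he hw α hαL)
      · exact Submodule.mem_sup_right
          ((monomial_mem_restrictSupport k).mpr (Or.inl ⟨hαL, hα.1⟩))
    have hβmem : monomial β (f.coeff β) ∈ J.restrictScalars k ⊔
        restrictSupport k ((leadExponents φ e J)ᶜ \ {β}) := by
      have h1 := support_sum_monomial_coeff f
      rw [← Finset.add_sum_erase _ _ hβf, ← eq_sub_iff_add_eq] at h1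
      rw [h1]
      exact Submodule.sub_mem _ (Submodule.mem_sup_left hf) (Submodule.sum_mem _ hother)
    obtain ⟨j, hj, s, hs, hjs⟩ := Submodule.mem_sup.mp hβmem
    have hsβ : s.coeff β = 0 := by
      by_contra h0
      exact ((mem_restrictSupport_iff k).mp hs (mem_support_iff.mpr h0)).2 rfl
    have hj0 : j = 0 := by
      refine eq_zero_of_mem_restrictSupport hφ hJ hj ?_
      rw [← eq_sub_iff_add_eq] at hjs
      rw [hjs]
      exact Submodule.sub_mem _ ((monomial_mem_restrictSupport k).mpr (Or.inl hβL))
        (restrictSupport_mono k Set.sdiff_subset hs)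
    rw [hj0, zero_add] at hjs
    rw [hjs, coeff_monomial, if_pos rfl] at hsβ
    exact mem_support_iff.mp hβf hsβ
  · rw [Ideal.span_le]
    rintro _ ⟨α, hα, rfl⟩
    obtain ⟨m, hm, hle⟩ := h.exists_le α hα
    obtain ⟨γ, rfl⟩ := exists_add_of_le hle
    have hin : initialForm w (g m) = monomial m 1 := by
      ext β
      rw [coeff_initialForm, coeff_monomial]
      have hmm : m ∈ (g m).support := by simp [mem_support_iff, h.coeff_eq_one m hm]
      by_cases hβ : m = β
      · subst hβ
        rw [if_pos rfl, if_pos, h.coeff_eq_one m hm]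
        refine ⟨hmm, fun γ hγ ↦ ?_⟩
        rcases eq_or_ne γ m with rfl | hne
        · exact le_rfl
        · exact (hw m hm γ hγ hne).le
      · rw [if_neg hβ, if_neg]
        rintro ⟨hβs, hmin⟩
        exact absurd (hw m hm β hβs (Ne.symm hβ)) (hmin m hmm).not_gt
    have h2 : monomial (m + γ) (1 : k) = monomial γ 1 * initialForm w (g m) := by
      rw [hin, monomial_mul, one_mul, add_comm]
    change monomial (m + γ) (1 : k) ∈ _
    rw [h2]
    exact Ideal.mul_mem_left _ _ (Ideal.subset_span ⟨g m, h.mem m hm, rfl⟩)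

end Lead

/-- A weight in the interior of its class spans a maximal cone of the Gröbner fan. -/
theorem maximal_grobnerCone {J : Ideal (MvPolynomial σ k)} {w : σ → ℝ} {V : Set (σ → ℝ)}
    (hV : IsOpen V) (hwV : w ∈ V) (hVJ : ∀ w' ∈ V, initialIdeal w' J = initialIdeal w J) :
    Maximal (· ∈ grobnerFan J) (grobnerCone J w) ∧
      initialIdealOfCone J (grobnerCone J w) = initialIdeal w J := by
  -- If `w` lies in the closure of a class, the neighbourhood `V` meets that class.
  have key : ∀ w', w ∈ grobnerCone J w' → initialIdeal w' J = initialIdeal w J := by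
    intro w' hw'
    obtain ⟨v, hvV, hv⟩ := mem_closure_iff.mp hw' V hV hwV
    exact hv.symm.trans (hVJ v hvV)
  have hself : w ∈ grobnerCone J w := subset_closure rfl
  refine ⟨⟨⟨w, rfl⟩, ?_⟩, ?_⟩
  · rintro _ ⟨w', rfl⟩ hle
    have := key w' (hle hself)
    simp only [grobnerCone, this]
    exact le_rfl
  · apply le_antisymm
    · refine iSup₂_le fun w' hw' ↦ ?_
      rw [key w' (hw' ▸ hself)]
    · exact le_iSup₂_of_le w rfl le_rfl

/-- Real numbers independent over `ℚ` separate integral exponents; they serve as the tie-breaker. -/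
theorem exists_injective_realWeight (n : ℕ) :
    ∃ w : Fin n → ℝ, Function.Injective (realWeight w) := by
  obtain ⟨w, hw⟩ := exists_linearIndependent_of_le_rank (R := ℚ) (M := ℝ) (n := n)
    (by rw [Real.rank_rat_real]; exact (Cardinal.nat_lt_continuum n).le)
  refine ⟨w, fun α β h ↦ ?_⟩
  rw [Fintype.linearIndependent_iff] at hw
  have h0 := hw (fun i ↦ (α i : ℚ) - β i) (by
    simp only [sub_smul, Finset.sum_sub_distrib, sub_eq_zero, Rat.smul_def, Rat.cast_natCast]
    simpa only [realWeight_apply, mul_comm] using h)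
  ext i
  exact_mod_cast sub_eq_zero.mp (h0 i)

/-- The lexicographic refinement of two weights. -/
def lexWeight (w₀ w₁ : σ → ℝ) : (σ →₀ ℕ) →+ ℝ ×ₗ ℝ where
  toFun α := toLex (realWeight w₀ α, realWeight w₁ α)
  map_zero' := by simp
  map_add' α β := by simp [← toLex_add]

theorem lexWeight_injective (w₀ : σ → ℝ) {w₁ : σ → ℝ} (h : Function.Injective (realWeight w₁)) :
    Function.Injective (lexWeight w₀ w₁) :=
  fun _ _ hαβ ↦ h (congrArg Prod.snd (toLex.injective hαβ))

theorem lexWeight_lt_iff {w₀ w₁ : σ → ℝ} {α β : σ →₀ ℕ} :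
    lexWeight w₀ w₁ α < lexWeight w₀ w₁ β ↔ realWeight w₀ α < realWeight w₀ β ∨
      realWeight w₀ α = realWeight w₀ β ∧ realWeight w₁ α < realWeight w₁ β :=
  Prod.Lex.toLex_lt_toLex

open Filter Topology in
/-- Small perturbations of `w₀` in the direction `w₁` realize the lexicographic order on any finite
set of monomials. -/
theorem IsLeadBasis.exists_mem_compatibleWeights {w₀ w₁ : σ → ℝ} {e : σ → ℕ}
    {J : Ideal (MvPolynomial σ k)} {F : Finset (σ →₀ ℕ)} {g : (σ →₀ ℕ) → MvPolynomial σ k}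
    (h : IsLeadBasis (lexWeight w₀ w₁) e J F g) : (compatibleWeights F g).Nonempty := by
  have hadd : ∀ (ε : ℝ) (α : σ →₀ ℕ), realWeight (w₀ + ε • w₁) α =
      realWeight w₀ α + ε * realWeight w₁ α := by
    intro ε α
    simp only [realWeight_apply, Pi.add_apply, Pi.smul_apply, smul_eq_mul, add_mul,
      Finset.sum_add_distrib, Finset.mul_sum, mul_assoc]
  have hev : ∀ᶠ ε : ℝ in 𝓝[>] 0, ∀ m ∈ F, ∀ β ∈ (g m).support, β ≠ m →
      realWeight (w₀ + ε • w₁) m < realWeight (w₀ + ε • w₁) β := by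
    rw [Finset.eventually_all]
    intro m hm
    rw [Finset.eventually_all]
    intro β hβ
    rw [eventually_imp_distrib_left]
    intro hne
    simp only [hadd]
    -- A strict inequality for `w₀` survives small `ε` by continuity; a tie is decided by `w₁` for
    -- every `ε > 0`.
    rcases lexWeight_lt_iff.mp (h.lt m hm β hβ hne) with hlt | ⟨heq, hlt⟩
    · have hcont : ∀ α : σ →₀ ℕ,
          Tendsto (fun ε : ℝ ↦ realWeight w₀ α + ε * realWeight w₁ α) (𝓝[>] 0)
            (𝓝 (realWeight w₀ α)) := by
        intro α
        have : Continuous fun ε : ℝ ↦ realWeight w₀ α + ε * realWeight w₁ α := by fun_prop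
        simpa using (this.tendsto 0).mono_left nhdsWithin_le_nhds
      exact (hcont m).eventually_lt (hcont β) hlt
    · filter_upwards [self_mem_nhdsWithin] with ε hε
      rw [heq]
      have := mul_lt_mul_of_pos_left hlt (Set.mem_Ioi.mp hε)
      linarith
  obtain ⟨ε, hε⟩ := hev.exists
  exact ⟨w₀ + ε • w₁, hε⟩

end InitialIdeals

/-! ### Morphisms between `Proj`s induced by ring maps -/

section InducedMorphisms

open Limits

variable {k A B D : Type u} [Field k] [CommRing A] [Algebra k A] [CommRing B] [Algebra k B]
  [CommRing D] [Algebra k D]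
  {𝒜 : ℕ → Submodule k A} {ℬ : ℕ → Submodule k B} {𝒟 : ℕ → Submodule k D}
  [GradedAlgebra 𝒜] [GradedAlgebra ℬ] [GradedAlgebra 𝒟]

theorem awayMap_mk {s : B →ₐ[k] A} {N : ℕ} (hs : MultipliesDegree ℬ 𝒜 s N) {f : B} {m : ℕ}
    (hf : f ∈ ℬ m) (l : ℕ) (a : B) (ha : a ∈ ℬ (l • m)) :
    ToricEmbedding.awayMap hs f (Away.mk ℬ hf l a ha) = Away.mk 𝒜 (hs.mem hf) l (s a)
      (by have := hs.mem ha; rwa [smul_eq_mul, mul_left_comm] at this) := by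
  apply val_injective
  rw [Away.val_mk]
  change Localization.mk _ _ = _
  congr 1
  exact Subtype.ext (map_pow s f l)

/-- Naturality of restriction from `D₊(f)` to `D₊(f * g)`, which is what the gluing needs. -/
theorem awayMap_comp_awayMap {s : B →ₐ[k] A} {N : ℕ} (hs : MultipliesDegree ℬ 𝒜 s N)
    {f g : B} {m' m : ℕ} (hf : f ∈ ℬ m') (hg : g ∈ ℬ m) :
    (ToricEmbedding.awayMap hs (f * g)).comp (HomogeneousLocalization.awayMap ℬ hg rfl) =
      (HomogeneousLocalization.awayMap 𝒜 (hs.mem hg) (map_mul s f g)).comp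
        (ToricEmbedding.awayMap hs f) := by
  refine RingHom.ext fun x ↦ val_injective _ ?_
  obtain ⟨l, a, ha, rfl⟩ := Away.mk_surjective ℬ hf x
  simp only [RingHom.comp_apply, awayMap_mk, HomogeneousLocalization.awayMap_mk, Away.val_mk,
    map_mul, map_pow]

theorem awayMap_comp {s : B →ₐ[k] A} {N : ℕ} (hs : MultipliesDegree ℬ 𝒜 s N)
    {t : D →ₐ[k] B} {M : ℕ} (ht : MultipliesDegree 𝒟 ℬ t M) {L : ℕ}
    (hst : MultipliesDegree 𝒟 𝒜 (s.comp t) L) {f : D} {m : ℕ} (hf : f ∈ 𝒟 m) :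
    (ToricEmbedding.awayMap hs (t f)).comp (ToricEmbedding.awayMap ht f) =
      ToricEmbedding.awayMap hst f := by
  refine RingHom.ext fun x ↦ val_injective _ ?_
  obtain ⟨l, a, ha, rfl⟩ := Away.mk_surjective 𝒟 hf x
  rw [RingHom.comp_apply, awayMap_mk ht hf, awayMap_mk hs]
  exact (congrArg HomogeneousLocalization.val (awayMap_mk hst hf l a ha)).symm

/-- The local pieces of the morphism induced by `s` agree on overlaps. -/
theorem awayMap_awayι_compatible {s : B →ₐ[k] A} {N : ℕ} (hN : 0 < N)
    (hs : MultipliesDegree ℬ 𝒜 s N) {m m' : ℕ} (hm : 0 < m) (hm' : 0 < m') {f g : B}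
    (hf : f ∈ ℬ m) (hg : g ∈ ℬ m') {X : Scheme.{u}}
    (p : X ⟶ Spec (.of <| Away 𝒜 (s f))) (q : X ⟶ Spec (.of <| Away 𝒜 (s g)))
    (h : p ≫ Proj.awayι 𝒜 (s f) (hs.mem hf) (Nat.mul_pos hN hm) =
      q ≫ Proj.awayι 𝒜 (s g) (hs.mem hg) (Nat.mul_pos hN hm')) :
    p ≫ Spec.map (CommRingCat.ofHom (ToricEmbedding.awayMap hs f)) ≫ Proj.awayι ℬ f hf hm =
      q ≫ Spec.map (CommRingCat.ofHom (ToricEmbedding.awayMap hs g)) ≫ Proj.awayι ℬ g hg hm' := by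
  -- The intersection of the two charts is `Spec A_(s f * s g)`, so `p` and `q` both factor through
  -- one map `l` into it.
  obtain ⟨l, hl⟩ : ∃ l, l = pullback.lift p q h ≫ (Proj.pullbackAwayιIso 𝒜 (hs.mem hf) (Nat.mul_pos hN hm)
    (hs.mem hg) (Nat.mul_pos hN hm') (map_mul s f g)).hom := ⟨_, rfl⟩
  have hp : p = l ≫ Spec.map (CommRingCat.ofHom
      (HomogeneousLocalization.awayMap 𝒜 (hs.mem hg) (map_mul s f g))) := by
    simp only [hl, Category.assoc, Proj.pullbackAwayιIso_hom_SpecMap_awayMap_left,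
      pullback.lift_fst]
  have hq : q = l ≫ Spec.map (CommRingCat.ofHom (HomogeneousLocalization.awayMap 𝒜 (hs.mem hf)
      ((map_mul s f g).trans (mul_comm _ _)))) := by
    simp only [hl, Category.assoc, Proj.pullbackAwayιIso_hom_SpecMap_awayMap_right,
      pullback.lift_snd]
  have hfg := awayMap_comp_awayMap hs hf hg
  have hgf : (ToricEmbedding.awayMap hs (f * g)).comp
      (HomogeneousLocalization.awayMap ℬ hf (mul_comm f g)) =
      (HomogeneousLocalization.awayMap 𝒜 (hs.mem hf)
        ((map_mul s f g).trans (mul_comm _ _))).comp (ToricEmbedding.awayMap hs g) := by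
    -- The product is replaced by a variable because `f * g` and `g * f` index different types.
    have key : ∀ (x : B) (hx : x = g * f) (hx' : s x = s g * s f),
        (ToricEmbedding.awayMap hs x).comp (HomogeneousLocalization.awayMap ℬ hf hx) =
        (HomogeneousLocalization.awayMap 𝒜 (hs.mem hf) hx').comp
          (ToricEmbedding.awayMap hs g) := by
      rintro x rfl hx'
      exact awayMap_comp_awayMap hs hg hf
    exact key _ _ _
  rw [hp, hq, Category.assoc, Category.assoc, ← Spec.map_comp_assoc, ← Spec.map_comp_assoc,
    ← CommRingCat.ofHom_comp, ← CommRingCat.ofHom_comp, ← hfg, ← hgf, CommRingCat.ofHom_comp,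
    CommRingCat.ofHom_comp, Spec.map_comp_assoc, Spec.map_comp_assoc]
  congr 2
  rw [Proj.SpecMap_awayMap_awayι ℬ hf hm hg rfl,
    Proj.SpecMap_awayMap_awayι ℬ hg hm' hf (mul_comm f g)]
  rfl

/-- An element of `B₊` is the sum of its homogeneous components of positive degree, so these suffice
to test vanishing. -/
theorem mem_definednessLocus_iff {s : B →ₐ[k] A} (x : Proj 𝒜) :
    x ∈ definednessLocus ℬ 𝒜 s ↔ ∃ m, 0 < m ∧ ∃ f ∈ ℬ m, x ∈ Proj.basicOpen 𝒜 (s f) := by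
  classical
  constructor
  · intro hx
    obtain ⟨_, ⟨b, hb, rfl⟩, hbx⟩ := Set.not_subset.mp hx
    by_contra! hcon
    apply hbx
    rw [← DirectSum.sum_support_decompose ℬ b, map_sum]
    refine sum_mem fun m _ ↦ ?_
    rcases Nat.eq_zero_or_pos m with rfl | hm
    · have : (DirectSum.decompose ℬ b 0 : B) = 0 :=
        (HomogeneousIdeal.mem_irrelevant_iff ℬ b).mp hb
      rw [this, map_zero]
      exact zero_mem _
    · by_contra hmx
      exact hcon m hm _ (DirectSum.decompose ℬ b m).2 hmx
  · rintro ⟨m, hm, f, hf, hx⟩ h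
    exact hx (h ⟨f, (HomogeneousIdeal.mem_irrelevant_iff ℬ f).mpr
      (DirectSum.decompose_of_mem_ne ℬ hf hm.ne'), rfl⟩)

/-- The sets `U ∩ D₊(s f)` with `f` homogeneous of positive degree cover `U`. -/
def inducedCover {s : B →ₐ[k] A} {N : ℕ} (hN : 0 < N) (hs : MultipliesDegree ℬ 𝒜 s N)
    {U : (Proj 𝒜).Opens} (hU : U ≤ definednessLocus ℬ 𝒜 s) :
    Scheme.OpenCover.{u} (U : Scheme.{u}) where
  I₀ := Σ m : {m : ℕ // 0 < m}, ℬ m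
  X i := pullback U.ι (Proj.awayι 𝒜 (s i.2) (hs.mem i.2.2) (Nat.mul_pos hN i.1.2))
  f i := pullback.fst U.ι (Proj.awayι 𝒜 (s i.2) (hs.mem i.2.2) (Nat.mul_pos hN i.1.2))
  mem₀ := by
    rw [Scheme.presieve₀_mem_precoverage_iff]
    refine ⟨fun x ↦ ?_, fun i ↦ inferInstance⟩
    obtain ⟨m, hm, f, hf, hx⟩ := (mem_definednessLocus_iff _).mp (hU x.2)
    refine ⟨⟨⟨m, hm⟩, ⟨f, hf⟩⟩, ?_⟩
    rw [IsOpenImmersion.range_pullbackFst]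
    change U.ι x ∈ (Proj.awayι 𝒜 _ _ _).opensRange
    rw [Proj.opensRange_awayι]
    exact hx

theorem pullback_fst_comp_eq {X Y Z W V V' : Scheme.{u}} {a : X ⟶ Z} {b : Y ⟶ Z} {w : Z ⟶ W}
    {v : V ⟶ W} {v' : V' ⟶ W} {c : X ⟶ V} {d : Y ⟶ V'} [HasPullback a b] (h : a ≫ w = c ≫ v)
    (h' : b ≫ w = d ≫ v') : (pullback.fst a b ≫ c) ≫ v = (pullback.snd a b ≫ d) ≫ v' := by
  rw [Category.assoc, Category.assoc, ← h, ← h', pullback.condition_assoc]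

theorem exists_isInducedBy {s : B →ₐ[k] A} {N : ℕ} (hN : 0 < N)
    (hs : MultipliesDegree ℬ 𝒜 s N) {U : (Proj 𝒜).Opens} (hU : U ≤ definednessLocus ℬ 𝒜 s) :
    ∃ φ : (U : Scheme.{u}) ⟶ Proj ℬ, IsInducedBy hN hs φ := by
  refine ⟨(inducedCover hN hs hU).glueMorphisms
    (fun i ↦ pullback.snd _ _ ≫ Spec.map (CommRingCat.ofHom (ToricEmbedding.awayMap hs i.2)) ≫
      Proj.awayι ℬ (i.2 : B) i.2.2 i.1.2) ?_, hU, ?_⟩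
  · intro i j
    have h := awayMap_awayι_compatible hN hs i.1.2 j.1.2 i.2.2 j.2.2
      (pullback.fst ((inducedCover hN hs hU).f i) ((inducedCover hN hs hU).f j) ≫
        pullback.snd U.ι (Proj.awayι 𝒜 (s i.2) (hs.mem i.2.2) (Nat.mul_pos hN i.1.2)))
      (pullback.snd ((inducedCover hN hs hU).f i) ((inducedCover hN hs hU).f j) ≫
        pullback.snd U.ι (Proj.awayι 𝒜 (s j.2) (hs.mem j.2.2) (Nat.mul_pos hN j.1.2)))
      (pullback_fst_comp_eq pullback.condition pullback.condition)
    exact (Category.assoc _ _ _).symm.trans (h.trans (Category.assoc _ _ _))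
  · intro m hm f hf
    exact (inducedCover hN hs hU).ι_glueMorphisms _ _ ⟨⟨m, hm⟩, ⟨f, hf⟩⟩

/-- A morphism induced by `s` sends `D₊(s f)` to `D₊(f)`. -/
theorem IsInducedBy.apply_mem_basicOpen {s : B →ₐ[k] A} {N : ℕ} {hN : 0 < N}
    {hs : MultipliesDegree ℬ 𝒜 s N} {U : (Proj 𝒜).Opens} {φ : (U : Scheme.{u}) ⟶ Proj ℬ}
    (h : IsInducedBy hN hs φ) {m : ℕ} (hm : 0 < m) {f : B} (hf : f ∈ ℬ m)
    (x : (U : Scheme.{u})) (hx : U.ι x ∈ Proj.basicOpen 𝒜 (s f)) :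
    φ x ∈ Proj.basicOpen ℬ f := by
  rw [← Proj.opensRange_awayι 𝒜 (s f) (hs.mem hf) (Nat.mul_pos hN hm)] at hx
  have : x ∈ Set.range (pullback.fst U.ι
      (Proj.awayι 𝒜 (s f) (hs.mem hf) (Nat.mul_pos hN hm))) := by
    rw [IsOpenImmersion.range_pullbackFst]
    exact hx
  obtain ⟨y, rfl⟩ := this
  rw [← Scheme.Hom.comp_apply, h.2 m hm f hf, ← Category.assoc, Scheme.Hom.comp_apply,
    ← Proj.opensRange_awayι ℬ f hf hm]
  exact ⟨_, rfl⟩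

theorem IsInducedBy.comp {s : B →ₐ[k] A} {t : D →ₐ[k] B} {M N L : ℕ} {hN : 0 < N} {hM : 0 < M}
    {hs : MultipliesDegree ℬ 𝒜 s N} {ht : MultipliesDegree 𝒟 ℬ t M} (hL : 0 < L)
    (hst : MultipliesDegree 𝒟 𝒜 (s.comp t) L)
    {U : (Proj 𝒜).Opens} {V : (Proj ℬ).Opens} {ψ : (U : Scheme.{u}) ⟶ (V : Scheme.{u})}
    {χ : (V : Scheme.{u}) ⟶ Proj 𝒟} (hU : U ≤ definednessLocus 𝒟 𝒜 (s.comp t))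
    (hψ : IsInducedBy hN hs (ψ ≫ V.ι)) (hχ : IsInducedBy hM ht χ) :
    IsInducedBy hL hst (ψ ≫ χ) := by
  refine ⟨hU, fun m hm f hf ↦ ?_⟩
  have h1 := hψ.2 (M * m) (Nat.mul_pos hM hm) (t f) (ht.mem hf)
  have h2 := hχ.2 m hm f hf
  -- `l` sends the chart `U ∩ D₊(s (t f))` into the chart `V ∩ D₊(t f)`, where the local formula for
  -- `χ` applies.
  let l := pullback.lift _ _ ((Category.assoc _ _ _).trans (h1.trans (Category.assoc _ _ _).symm))
  have e1 : l ≫ pullback.fst _ _ = _ := pullback.lift_fst _ _ _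
  have e2 : l ≫ pullback.snd _ _ = _ := pullback.lift_snd _ _ _
  have h3 : l ≫ _ = l ≫ _ := congrArg (l ≫ ·) h2
  rw [← Category.assoc, e1, ← Category.assoc, e2, Category.assoc, Category.assoc,
    ← Spec.map_comp_assoc, ← CommRingCat.ofHom_comp, awayMap_comp hs ht hst hf] at h3
  exact h3

theorem definednessLocus_comp_le {s : B →ₐ[k] A} {t : D →ₐ[k] B} {M : ℕ} (hM : 0 < M)
    (ht : MultipliesDegree 𝒟 ℬ t M) :
    definednessLocus 𝒟 𝒜 (s.comp t) ≤ definednessLocus ℬ 𝒜 s := by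
  intro x hx
  obtain ⟨m, hm, f, hf, hx⟩ := (mem_definednessLocus_iff _).mp hx
  exact (mem_definednessLocus_iff _).mpr ⟨M * m, Nat.mul_pos hM hm, t f, ht.mem hf, hx⟩

/-- A morphism induced by `s` on the locus of definedness of `s ∘ t` has image in the locus of
definedness of `t`. -/
theorem IsInducedBy.exists_lift {s : B →ₐ[k] A} {t : D →ₐ[k] B} {M N : ℕ} {hN : 0 < N}
    (hM : 0 < M) {hs : MultipliesDegree ℬ 𝒜 s N} (ht : MultipliesDegree 𝒟 ℬ t M)
    {φ : (definednessLocus 𝒟 𝒜 (s.comp t) : Scheme.{u}) ⟶ Proj ℬ} (h : IsInducedBy hN hs φ) :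
    ∃ ψ : (definednessLocus 𝒟 𝒜 (s.comp t) : Scheme.{u}) ⟶
      (definednessLocus 𝒟 ℬ t : Scheme.{u}), ψ ≫ Scheme.Opens.ι _ = φ := by
  have hrange : Set.range φ ⊆ Set.range (definednessLocus 𝒟 ℬ t).ι := by
    rw [Scheme.Opens.range_ι]
    rintro _ ⟨x, rfl⟩
    obtain ⟨m, hm, f, hf, hx⟩ := (mem_definednessLocus_iff _).mp x.2
    exact (mem_definednessLocus_iff _).mpr
      ⟨m, hm, f, hf, h.apply_mem_basicOpen (Nat.mul_pos hM hm) (ht.mem hf) x hx⟩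
  exact ⟨IsOpenImmersion.lift _ φ hrange, IsOpenImmersion.lift_fac _ _ _⟩

/-- The generic point of `Proj` of a graded domain. -/
def genericPoint [IsDomain A] {m : ℕ} (hm : 0 < m) {a : A} (ha : a ∈ 𝒜 m) (ha0 : a ≠ 0) :
    ProjectiveSpectrum 𝒜 where
  asHomogeneousIdeal := ⊥
  isPrime := by
    rw [HomogeneousIdeal.toIdeal_bot]
    exact Ideal.isPrime_bot
  not_irrelevant_le h := ha0 <| by
    have h1 : a ∈ HomogeneousIdeal.irrelevant 𝒜 :=
      (HomogeneousIdeal.mem_irrelevant_iff 𝒜 a).mpr (DirectSum.decompose_of_mem_ne 𝒜 ha hm.ne')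
    simpa using (show a ∈ (⊥ : HomogeneousIdeal 𝒜).toIdeal from h h1)

theorem genericPoint_mem_basicOpen [IsDomain A] {m : ℕ} (hm : 0 < m) {a : A} (ha : a ∈ 𝒜 m)
    (ha0 : a ≠ 0) {f : A} (hf : f ≠ 0) :
    genericPoint hm ha ha0 ∈ ProjectiveSpectrum.basicOpen 𝒜 f := by
  intro h
  apply hf
  simpa using (show f ∈ (⊥ : HomogeneousIdeal 𝒜).toIdeal from h)

/-- A homogeneous basic open set can be refined by one of positive degree. -/
theorem exists_homogeneous_basicOpen_le (x : Proj ℬ) {O : Set (Proj ℬ)} (hO : IsOpen O)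
    (hx : x ∈ O) : ∃ m, 0 < m ∧ ∃ f ∈ ℬ m, x ∈ Proj.basicOpen ℬ f ∧
      ∀ y ∈ Proj.basicOpen ℬ f, y ∈ O := by
  obtain ⟨_, ⟨_, ⟨f, rfl⟩, rfl⟩, hxf, hfO⟩ :=
    (Proj.isBasis_basicOpen ℬ).exists_subset_of_mem_open hx hO
  classical
  obtain ⟨i, hi⟩ : ∃ i, (DirectSum.decompose ℬ f i : B) ∉ x.asHomogeneousIdeal := by
    by_contra! hcon
    apply hxf
    rw [← DirectSum.sum_support_decompose ℬ f]
    exact sum_mem fun i _ ↦ hcon i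
  -- The component of `f` avoiding `x` may have degree zero. Multiplying by a homogeneous element of
  -- positive degree outside `x` repairs this, and one exists since `x` does not contain the
  -- irrelevant ideal.
  obtain ⟨g, hg, hgx⟩ := SetLike.not_le_iff_exists.mp x.not_irrelevant_le
  obtain ⟨j, hj, hjx⟩ : ∃ j, 0 < j ∧ (DirectSum.decompose ℬ g j : B) ∉ x.asHomogeneousIdeal := by
    by_contra! hcon
    apply hgx
    rw [← DirectSum.sum_support_decompose ℬ g]
    refine sum_mem fun m _ ↦ ?_
    rcases Nat.eq_zero_or_pos m with rfl | hm
    · have : (DirectSum.decompose ℬ g 0 : B) = 0 :=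
        (HomogeneousIdeal.mem_irrelevant_iff ℬ g).mp hg
      rw [this]
      exact zero_mem _
    · exact hcon m hm
  refine ⟨i + j, by omega, _, SetLike.mul_mem_graded (DirectSum.decompose ℬ f i).2
    (DirectSum.decompose ℬ g j).2, ?_, fun y hy ↦ hfO ?_⟩
  · rw [Proj.basicOpen_mul]
    exact ⟨hi, hjx⟩
  · rw [Proj.basicOpen_mul] at hy
    have hle : Proj.basicOpen ℬ (DirectSum.decompose ℬ f i : B) ≤ Proj.basicOpen ℬ f := by
      rw [Proj.basicOpen_eq_iSup_proj ℬ f]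
      exact le_iSup (fun i ↦ Proj.basicOpen ℬ (GradedRing.proj ℬ i f)) i
    exact hle hy.1

theorem basicOpen_le_definednessLocus {s : B →ₐ[k] A} {m : ℕ} (hm : 0 < m) {f : B}
    (hf : f ∈ ℬ m) : Proj.basicOpen 𝒜 (s f) ≤ definednessLocus ℬ 𝒜 s :=
  fun _ hx ↦ (mem_definednessLocus_iff _).mpr ⟨m, hm, f, hf, hx⟩

/-- The zero ideal is a point of every `D₊(g)` with `g ≠ 0`, hence of every nonempty open set, and
it lies in `D₊(s f)` as well. -/
theorem dense_definednessLocus [IsDomain A] {s : B →ₐ[k] A} {m : ℕ} (hm : 0 < m) {f : B}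
    (hf : f ∈ ℬ m) (hsf : s f ≠ 0) : Dense (definednessLocus ℬ 𝒜 s : Set (Proj 𝒜)) := by
  intro x
  rw [mem_closure_iff]
  intro O hO hxO
  obtain ⟨n, hn, g, hg, hxg, hgO⟩ := exists_homogeneous_basicOpen_le x hO hxO
  have hg0 : g ≠ 0 := by
    rintro rfl
    simp at hxg
  exact ⟨genericPoint hn hg hg0, hgO _ (genericPoint_mem_basicOpen hn hg hg0 hg0),
    basicOpen_le_definednessLocus hm hf (genericPoint_mem_basicOpen hn hg hg0 hsf)⟩

/-- A nonempty open set contains some `D₊(g)` with `g ≠ 0`. Injectivity gives `s g ≠ 0`, so the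
generic point maps into `D₊(g)`. -/
theorem IsInducedBy.isDominant [IsDomain A] {s : B →ₐ[k] A} {N : ℕ} {hN : 0 < N}
    {hs : MultipliesDegree ℬ 𝒜 s N}
    {φ : (definednessLocus ℬ 𝒜 s : Scheme.{u}) ⟶ Proj ℬ} (h : IsInducedBy hN hs φ)
    (hinj : Function.Injective s) : IsDominant φ := by
  refine ⟨fun x ↦ ?_⟩
  rw [mem_closure_iff]
  intro O hO hxO
  obtain ⟨n, hn, g, hg, hxg, hgO⟩ := exists_homogeneous_basicOpen_le x hO hxO
  have hg0 : s g ≠ 0 := by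
    rw [Ne, map_eq_zero_iff s hinj]
    rintro rfl
    simp at hxg
  have hp := genericPoint_mem_basicOpen (Nat.mul_pos hN hn) (hs.mem hg) hg0 hg0
  let y : (definednessLocus ℬ 𝒜 s : Scheme.{u}) :=
    ⟨genericPoint (Nat.mul_pos hN hn) (hs.mem hg) hg0, basicOpen_le_definednessLocus hn hg hp⟩
  exact ⟨φ y, hgO _ (h.apply_mem_basicOpen hn hg y hp), y, rfl⟩

/-- The morphism induced by a composite of two ring maps, and its factorization. -/
theorem exists_induced_factorization [IsDomain A] {s : B →ₐ[k] A} {t : D →ₐ[k] B} {M N L : ℕ}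
    (hN : 0 < N) (hM : 0 < M) (hL : 0 < L) (hs : MultipliesDegree ℬ 𝒜 s N)
    (ht : MultipliesDegree 𝒟 ℬ t M) (hst : MultipliesDegree 𝒟 𝒜 (s.comp t) L)
    (hinj : Function.Injective (s.comp t)) :
    ∃ (φ : (definednessLocus 𝒟 𝒜 (s.comp t) : Scheme.{u}) ⟶ Proj 𝒟)
      (ψ : (definednessLocus 𝒟 𝒜 (s.comp t) : Scheme.{u}) ⟶ (definednessLocus 𝒟 ℬ t : Scheme.{u}))
      (χ : (definednessLocus 𝒟 ℬ t : Scheme.{u}) ⟶ Proj 𝒟),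
      IsInducedBy hL hst φ ∧ IsInducedBy hN hs (ψ ≫ Scheme.Opens.ι _) ∧ IsInducedBy hM ht χ ∧
        ψ ≫ χ = φ ∧ IsDominant φ := by
  obtain ⟨χ, hχ⟩ := exists_isInducedBy hM ht le_rfl
  obtain ⟨ψ', hψ'⟩ := exists_isInducedBy hN hs (definednessLocus_comp_le (𝒜 := 𝒜) (s := s) hM ht)
  obtain ⟨ψ, rfl⟩ := hψ'.exists_lift hM ht
  have h := IsInducedBy.comp hL hst le_rfl hψ' hχ
  exact ⟨ψ ≫ χ, ψ, χ, h, hψ', hχ, rfl, h.isDominant hinj⟩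

end InducedMorphisms

/-! ### Graded presentations -/

section Presentation

open MvPolynomial

variable {k R : Type*} [Field k] [CommRing R] [Algebra k R] {𝒜 : ℕ → Submodule k R}
  [GradedAlgebra 𝒜] {σ : Type*} {e : σ → ℕ}

theorem aeval_mem_of_isWeightedHomogeneous {b : σ → R} (hb : ∀ i, b i ∈ 𝒜 (e i)) {m : ℕ}
    {f : MvPolynomial σ k} (hf : IsWeightedHomogeneous e f m) : aeval b f ∈ 𝒜 m := by
  rw [← support_sum_monomial_coeff f, map_sum]
  refine Submodule.sum_mem _ fun α hα ↦ ?_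
  rw [aeval_monomial, ← Algebra.smul_def]
  refine Submodule.smul_mem _ _ ?_
  rw [← hf (mem_support_iff.mp hα), Finsupp.weight_apply]
  exact SetLike.prod_mem_graded 𝒜 _ _ fun i _ ↦ SetLike.pow_mem_graded _ (hb i)

/-- This makes the ideal of relations homogeneous for the grading by `e`. -/
theorem decompose_aeval {b : σ → R} (hb : ∀ i, b i ∈ 𝒜 (e i)) (f : MvPolynomial σ k) (m : ℕ) :
    (DirectSum.decompose 𝒜 (aeval b f) m : R) = aeval b (weightedHomogeneousComponent e m f) := by
  classical
  induction f using induction_on' with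
  | monomial α c =>
    have hα : IsWeightedHomogeneous e (monomial α c) (Finsupp.weight e α) :=
      isWeightedHomogeneous_monomial e α c rfl
    have hmem := aeval_mem_of_isWeightedHomogeneous hb hα
    rw [weightedHomogeneousComponent_of_mem hα]
    split_ifs with h
    · rw [h]
      exact DirectSum.decompose_of_mem_same 𝒜 hmem
    · rw [map_zero]
      exact DirectSum.decompose_of_mem_ne 𝒜 hmem (Ne.symm h)
  | add p q hp hq =>
    simp only [map_add, DirectSum.decompose_add, DirectSum.add_apply, Submodule.coe_add, hp, hq]

theorem weightedHomogeneousComponent_mem_ker {b : σ → R} (hb : ∀ i, b i ∈ 𝒜 (e i))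
    {f : MvPolynomial σ k} (hf : aeval b f = 0) (m : ℕ) :
    aeval b (weightedHomogeneousComponent e m f) = 0 := by
  rw [← decompose_aeval hb, hf]
  simp

theorem exists_algebraMap_eq_of_mem_zero {b : σ → R} (hb : ∀ i, b i ∈ 𝒜 (e i))
    (he : ∀ i, 0 < e i) (hsurj : Function.Surjective (aeval b : MvPolynomial σ k →ₐ[k] R)) {x : R}
    (hx : x ∈ 𝒜 0) : ∃ c : k, algebraMap k R c = x := by
  obtain ⟨f, rfl⟩ := hsurj x
  refine ⟨f.coeff 0, ?_⟩
  have h := decompose_aeval (k := k) hb f 0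
  rw [DirectSum.decompose_of_mem_same 𝒜 hx,
    weightedHomogeneousComponent_zero f fun i ↦ (he i).ne'] at h
  rw [h, aeval_C]

/-- The only element of degree zero in the value semigroup is zero. -/
theorem eq_zero_of_mem_valueSemigroup [IsDomain R] {r : ℕ} (ν : HomogeneousValuation k 𝒜 r)
    (h0 : ∀ x ∈ 𝒜 0, ∃ c : k, algebraMap k R c = x) (s : ℕ × (Fin r → ℤ))
    (hs : s ∈ ν.valueSemigroup) (hs0 : s.1 = 0) : s = 0 := by
  classical
  obtain ⟨f, hf, rfl⟩ := hs
  have hne : ∀ i ∈ (DirectSum.decompose 𝒜 f).support, (DirectSum.decompose 𝒜 f i : R) ≠ 0 := by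
    intro i hi h
    exact DFinsupp.mem_support_iff.mp hi (Subtype.ext h)
  have hdeg : ∀ i ∈ (DirectSum.decompose 𝒜 f).support,
      (ν.toFun (DirectSum.decompose 𝒜 f i : R)).1 = i :=
    fun i hi ↦ ν.fst_eq_degree i _ (DirectSum.decompose 𝒜 f i).2 (hne i hi)
  have hsum := DirectSum.sum_support_decompose 𝒜 f
  have hnonempty : (DirectSum.decompose 𝒜 f).support.Nonempty := by
    by_contra h
    rw [Finset.not_nonempty_iff_eq_empty.mp h, Finset.sum_empty] at hsum
    exact hf hsum.symm
  -- Components of different degrees have different values, so the value of `f` is that of one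
  -- component. In degree zero that component is a nonzero scalar, of value `0`.
  obtain ⟨-, i, hi, h⟩ := ν.exists_map_sum_eq _ hnonempty _ hne fun i hi j hj hij ↦ by
    rw [← hdeg i hi, ← hdeg j hj]
    exact congrArg Prod.fst hij
  rw [hsum] at h
  rw [h, hdeg i hi] at hs0
  subst hs0
  obtain ⟨c, hc⟩ := h0 _ (DirectSum.decompose 𝒜 f 0).2
  have hc0 : c ≠ 0 := by
    rintro rfl
    exact hne 0 hi (by rw [← hc, map_zero])
  rw [h, ← hc, Algebra.algebraMap_eq_smul_one, ν.map_smul c 1 hc0 one_ne_zero, ν.map_one]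

/-- For algebraically independent generators there is a maximal cone of the Gröbner fan such that
all monomials in these generators are standard. -/
theorem exists_maximal_grobnerCone {n d : ℕ} {e : Fin n → ℕ} {b : Fin n → R}
    (hb : ∀ i, b i ∈ 𝒜 (e i)) (he : ∀ i, 0 < e i)
    (hsurj : Function.Surjective (aeval b : MvPolynomial (Fin n) k →ₐ[k] R)) (ι : Fin d ↪ Fin n)
    (hι : AlgebraicIndependent k fun j ↦ b (ι j)) :
    ∃ C, Maximal (· ∈ grobnerFan (RingHom.ker (aeval b : MvPolynomial (Fin n) k →ₐ[k] R))) C ∧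
      LinearIndependent k (fun α : standardExponents
        (RingHom.ker (aeval b : MvPolynomial (Fin n) k →ₐ[k] R)) C =>
          aeval b (monomial (α : Fin n →₀ ℕ) (1 : k))) ∧
      Submodule.span k ((fun α => aeval b (monomial α (1 : k))) '' standardExponents
        (RingHom.ker (aeval b : MvPolynomial (Fin n) k →ₐ[k] R)) C) = ⊤ ∧
      ∀ α : Fin d →₀ ℕ, α.mapDomain ι ∈ standardExponents
        (RingHom.ker (aeval b : MvPolynomial (Fin n) k →ₐ[k] R)) C := by
  classical
  set J := RingHom.ker (aeval b : MvPolynomial (Fin n) k →ₐ[k] R)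
  have hJ : ∀ f ∈ J, ∀ m, weightedHomogeneousComponent e m f ∈ J :=
    fun f hf m ↦ weightedHomogeneousComponent_mem_ker hb hf m
  obtain ⟨w₁, hw₁⟩ := exists_injective_realWeight n
  -- The minimum convention makes `-1` the right sign: any monomial using another variable is
  -- smaller than every monomial in the chosen ones.
  let w₀ : Fin n → ℝ := fun i ↦ if i ∈ Set.range ι then 0 else -1
  have hinj := lexWeight_injective w₀ hw₁
  obtain ⟨F, g, hFg⟩ := exists_isLeadBasis (lexWeight w₀ w₁) e J
  obtain ⟨w, hw⟩ := hFg.exists_mem_compatibleWeights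
  have hin := fun w' hw' ↦ hFg.initialIdeal_eq he hinj hJ (w := w') hw'
  obtain ⟨hmax, hcone⟩ := maximal_grobnerCone (isOpen_compatibleWeights F g) hw
    fun w' hw' ↦ (hin w' hw').trans (hin w hw).symm
  have hstd : standardExponents J (grobnerCone J w) = (leadExponents (lexWeight w₀ w₁) e J)ᶜ := by
    ext α
    rw [standardExponents, Set.mem_ofPred_eq, hcone, hin w hw,
      monomial_mem_span_leadExponents_iff, Set.mem_compl_iff]
  refine ⟨grobnerCone J w, hmax, ?_, ?_, ?_⟩
  -- Independence in `R` says that the span of the standard monomials meets `J` only in `0`.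
  · have hli : LinearIndependent k fun α : standardExponents J (grobnerCone J w) ↦
        monomial (α : Fin n →₀ ℕ) (1 : k) := by
      have := (basisMonomials (Fin n) k).linearIndependent.comp
        (fun α : standardExponents J (grobnerCone J w) ↦ (α : Fin n →₀ ℕ)) Subtype.val_injective
      simpa only [Function.comp_def, coe_basisMonomials] using this
    refine hli.map (f := (aeval b : MvPolynomial (Fin n) k →ₐ[k] R).toLinearMap) ?_
    rw [Submodule.disjoint_def]
    intro f hf hker
    refine eq_zero_of_mem_restrictSupport hinj hJ (f := f) hker ?_
    rw [restrictSupport_eq_span, ← hstd, Set.image_eq_range]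
    exact hf
  · have htop := hFg.sup_restrictSupport_eq_top he hw
    have h1 := congrArg (Submodule.map
      (aeval b : MvPolynomial (Fin n) k →ₐ[k] R).toLinearMap) htop
    rw [Submodule.map_sup, Submodule.map_top, LinearMap.range_eq_top.mpr hsurj] at h1
    have h2 : Submodule.map (aeval b : MvPolynomial (Fin n) k →ₐ[k] R).toLinearMap
        (J.restrictScalars k) = ⊥ := by
      rw [eq_bot_iff]
      rintro _ ⟨f, hf, rfl⟩
      exact hf
    rw [h2, bot_sup_eq, restrictSupport_eq_span, Submodule.map_span, ← hstd, Set.image_image] at h1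
    exact h1
  · intro α
    rw [hstd]
    rintro ⟨f, hf, -, hc, hlt⟩
    have hw₀ : ∀ β : Fin d →₀ ℕ, realWeight w₀ (β.mapDomain ι) = 0 := by
      intro β
      rw [realWeight_apply]
      refine Finset.sum_eq_zero fun i _ ↦ ?_
      by_cases hi : i ∈ Set.range ι
      · simp only [w₀, if_pos hi, zero_mul]
      · rw [Finsupp.mapDomain_of_notMem_range β i hi]
        simp
    -- The leading exponent has `w₀`-weight `0` and is minimal, while a variable outside the range
    -- of `ι` would force a negative weight.
    have hvars : (f.vars : Set (Fin n)) ⊆ Set.range ι := by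
      intro i hi
      obtain ⟨β, hβ, hiβ⟩ := (mem_vars_iff_mem_support i).mp hi
      by_contra hir
      have hle : ∀ j ∈ Finset.univ, w₀ j * (β j : ℝ) ≤ 0 := by
        intro j _
        have : w₀ j ≤ 0 := by
          simp only [w₀]
          split_ifs <;> norm_num
        exact mul_nonpos_of_nonpos_of_nonneg this (Nat.cast_nonneg _)
      have hneg : realWeight w₀ β < 0 := by
        rw [realWeight_apply]
        refine Finset.sum_neg' hle ⟨i, Finset.mem_univ i, ?_⟩
        simp only [w₀, if_neg hir]
        have : 0 < β i := Nat.pos_of_ne_zero (Finsupp.mem_support_iff.mp hiβ)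
        have : (0 : ℝ) < β i := by exact_mod_cast this
        linarith
      rcases eq_or_ne β (α.mapDomain ι) with rfl | hne
      · rw [hw₀] at hneg
        exact lt_irrefl _ hneg
      · have := lexWeight_lt_iff.mp (hlt β hβ hne)
        rw [hw₀] at this
        rcases this with h | h
        · linarith
        · linarith [h.1]
    -- Now `f` is a relation among the independent elements, hence zero, against its leading
    -- coefficient `1`.
    obtain ⟨q, rfl⟩ := exists_rename_eq_of_vars_subset_range f ι ι.injective hvars
    have hq : aeval (fun j ↦ b (ι j)) q = 0 := by
      have : aeval b (rename ι q) = 0 := hf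
      rwa [aeval_rename] at this
    rw [(algebraicIndependent_iff.mp hι) q hq, map_zero, coeff_zero] at hc
    exact zero_ne_one hc

end Presentation

/-- The map of semigroup algebras induced by a homomorphism to `ℕ ^ m` that multiplies degrees. -/
theorem multipliesDegree_mapDomainAlgHom {k S : Type*} [Field k] [AddCommMonoid S] (deg : S →+ ℕ)
    {m N : ℕ} {e : Fin m → ℕ} (A : S →+ (Fin m →₀ ℕ))
    (hA : ∀ s, Finsupp.weight e (A s) = N * deg s) (l : ℕ) (f : AddMonoidAlgebra k S)
    (hf : f ∈ AddMonoidAlgebra.gradeBy k deg l) :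
    AddMonoidAlgebra.mapDomainAlgHom k k A f ∈
      MvPolynomial.weightedHomogeneousSubmodule k e (N * l) := by
  rw [AddMonoidAlgebra.mem_gradeBy_iff] at hf
  rw [← AddMonoidAlgebra.sum_coeff_single f, Finsupp.sum, map_sum]
  refine Submodule.sum_mem _ fun s hs ↦ ?_
  have hs' : deg s = l := hf hs
  rw [AddMonoidAlgebra.mapDomainAlgHom_apply, AddMonoidAlgebra.mapDomain_single]
  exact MvPolynomial.isWeightedHomogeneous_monomial e _ _ (by rw [hA, hs'])

end ToricEmbedding

end

/-! ### Construction of `η` and assembly of the theorem. -/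

theorem mainTheorem9 {k R : Type u} [Field k] [CommRing R] [IsDomain R] [Algebra k R]
    (𝒜 : ℕ → Submodule k R) [GradedAlgebra 𝒜]
    -- a full rank valuation with finitely generated value semigroup
    (d r : ℕ) (hdim : ringKrullDim R = ((d + 1 : ℕ) : WithBot ℕ∞))
    (ν : HomogeneousValuation k 𝒜 r) (hfull : ν.IsFullRank) (hfg : ν.valueSemigroup.FG)
    -- a graded presentation `R ≅ k[x₀, …, xₙ] / J` with variables of positive degrees
    (n : ℕ) (e : Fin (n + 1) → ℕ) (he : ∀ i, 0 < e i)
    (π : MvPolynomial (Fin (n + 1)) k →ₐ[k] R) (hπ : Function.Surjective π)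
    (hdeg : ∀ i, π (MvPolynomial.X i) ∈ 𝒜 (e i))
    (J : Ideal (MvPolynomial (Fin (n + 1)) k)) (hJ : J = RingHom.ker π)
    -- a maximal cone `τ` of the tropicalization of `J` with `k[S] ≅ k[x₀, …, xₙ] / in_τ(J)`
    (τ : Set (Fin (n + 1) → ℝ)) (hτ : Maximal (· ∈ tropicalFan J) τ)
    (hiso : Nonempty (ν.semigroupAlgebra ≃ₐ[k]
      (MvPolynomial (Fin (n + 1)) k ⧸ initialIdealOfCone J τ))) :
    ∃ C : Set (Fin (n + 1) → ℝ), Maximal (· ∈ grobnerFan J) C ∧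
      -- the standard monomials of `in_C(J)` form a basis of `R`
      LinearIndependent k
        (fun α : standardExponents J C => π (MvPolynomial.monomial (α : Fin (n + 1) →₀ ℕ) 1)) ∧
      Submodule.span k
        ((fun α => π (MvPolynomial.monomial α 1)) '' standardExponents J C) = ⊤ ∧
      ∃ (η : ν.semigroupAlgebra →ₐ[k] R) (N : ℕ) (hN : 0 < N)
        (hη : MultipliesDegree ν.grading 𝒜 η N),
        Function.Injective η ∧
        -- `η` sends the semigroup to standard monomials
        (∀ s : ν.valueSemigroup, ∃ α ∈ standardExponents J C,
          η (ν.character s) = π (MvPolynomial.monomial α 1)) ∧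
        -- `d + 1` algebraically independent generators of `R` such that `η` factors through
        -- the polynomial ring in these generators, graded by their degrees
        ∃ (ι : Fin (d + 1) ↪ Fin (n + 1))
          (θ : ν.semigroupAlgebra →ₐ[k] MvPolynomial (Fin (d + 1)) k)
          (hθ : MultipliesDegree ν.grading
            (MvPolynomial.weightedHomogeneousSubmodule k (fun j => e (ι j))) θ N)
          (hρ : MultipliesDegree
            (MvPolynomial.weightedHomogeneousSubmodule k (fun j => e (ι j))) 𝒜
            (MvPolynomial.aeval fun j => π (MvPolynomial.X (ι j))) 1),
          AlgebraicIndependent k (fun j => π (MvPolynomial.X (ι j))) ∧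
          (MvPolynomial.aeval fun j => π (MvPolynomial.X (ι j))).comp θ = η ∧
          -- the induced dominant rational map and its factorization
          Dense (definednessLocus ν.grading 𝒜 η : Set (Proj 𝒜)) ∧
          ∃ (φ : (definednessLocus ν.grading 𝒜 η : Scheme.{u}) ⟶ Proj ν.grading)
            (ψ : (definednessLocus ν.grading 𝒜 η : Scheme.{u}) ⟶
              (definednessLocus ν.grading
                (MvPolynomial.weightedHomogeneousSubmodule k (fun j => e (ι j))) θ : Scheme.{u}))
            (χ : (definednessLocus ν.grading
                (MvPolynomial.weightedHomogeneousSubmodule k (fun j => e (ι j))) θ : Scheme.{u}) ⟶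
              Proj ν.grading),
            IsInducedBy hN hη φ ∧
            IsInducedBy Nat.one_pos hρ (ψ ≫ Scheme.Opens.ι _) ∧
            IsInducedBy hN hθ χ ∧
            ψ ≫ χ = φ ∧
            IsDominant φ := by
  classical
  set b : Fin (n + 1) → R := fun i ↦ π (MvPolynomial.X i) with hb
  have hπb : π = MvPolynomial.aeval b := MvPolynomial.aeval_unique π
  have hsurj : Function.Surjective (MvPolynomial.aeval b : MvPolynomial (Fin (n + 1)) k →ₐ[k] R) :=
    hπb ▸ hπ
  have hrank : ν.rank = d + 1 := by
    have h := hfull.symm.trans hdim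
    exact_mod_cast h
  obtain ⟨ι, hι⟩ := ν.exists_algebraicIndependent_generators hrank b (by
    rw [Algebra.adjoin_range_eq_range_aeval]
    exact (AlgHom.range_eq_top _).mpr hsurj)
  obtain ⟨C, hC, hli, hspan, hstd⟩ := exists_maximal_grobnerCone hdeg he hsurj ι hι
  have hJb : J = RingHom.ker (MvPolynomial.aeval b : MvPolynomial (Fin (n + 1)) k →ₐ[k] R) := by
    rw [hJ, hπb]
  rw [← hJb] at hC hli hspan hstd
  rw [← hπb] at hli hspan
  obtain ⟨A, N, hN, hAinj, hA⟩ := exists_weighted_embedding ν.valueSemigroup hfg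
    (eq_zero_of_mem_valueSemigroup ν fun x hx ↦ exists_algebraMap_eq_of_mem_zero hdeg he hsurj hx)
    hrank (fun j ↦ e (ι j)) fun j ↦ he _
  let θ : ν.semigroupAlgebra →ₐ[k] MvPolynomial (Fin (d + 1)) k :=
    AddMonoidAlgebra.mapDomainAlgHom k k A
  let ρ : MvPolynomial (Fin (d + 1)) k →ₐ[k] R := MvPolynomial.aeval fun j ↦ b (ι j)
  have hθ : MultipliesDegree ν.grading
      (MvPolynomial.weightedHomogeneousSubmodule k fun j ↦ e (ι j)) θ N :=
    fun m f hf ↦ multipliesDegree_mapDomainAlgHom ν.degHom A hA m f hf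
  have hρ : MultipliesDegree (MvPolynomial.weightedHomogeneousSubmodule k fun j ↦ e (ι j)) 𝒜 ρ 1 :=
    fun m f hf ↦ by
      rw [one_mul]
      exact aeval_mem_of_isWeightedHomogeneous (fun j ↦ hdeg (ι j)) hf
  have hη : MultipliesDegree ν.grading 𝒜 (ρ.comp θ) N := fun m f hf ↦ by
    have := hρ.mem (hθ.mem hf)
    rwa [one_mul] at this
  have hinj : Function.Injective (ρ.comp θ) := by
    rw [AlgHom.coe_comp]
    exact Function.Injective.comp hι (AddMonoidAlgebra.mapDomain_injective hAinj)
  obtain ⟨φ, ψ, χ, hφ, hψ, hχ, hcomp, hdom⟩ :=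
    exists_induced_factorization Nat.one_pos hN hN hρ hθ hη hinj
  have hdense : Dense (definednessLocus ν.grading 𝒜 (ρ.comp θ) : Set (Proj 𝒜)) := by
    -- The value of any chosen generator has positive degree, so its character lies in `k[S]₊` and
    -- has nonzero image.
    have hpos : ∃ s : ν.valueSemigroup, 0 < ν.degHom s :=
      ⟨⟨ν.toFun (b (ι 0)), b (ι 0), hι.ne_zero 0, rfl⟩,
        (he (ι 0)).trans_eq (ν.fst_eq_degree _ _ (hdeg (ι 0)) (hι.ne_zero 0)).symm⟩
    obtain ⟨s, hs⟩ := hpos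
    refine dense_definednessLocus hs (f := ν.character s)
      (AddMonoidAlgebra.single_mem_gradeBy ν.degHom s 1) ?_
    rw [Ne, map_eq_zero_iff _ hinj]
    exact AddMonoidAlgebra.single_ne_zero.mpr one_ne_zero
  refine ⟨C, hC, hli, hspan, ρ.comp θ, N, hN, hη, hinj, fun s ↦ ?_, ι, θ, hθ, hρ, hι, rfl, hdense,
    φ, ψ, χ, hφ, hψ, hχ, hcomp, hdom⟩
  -- `η` sends `χ ^ s` to the monomial with exponent `A s` in the chosen generators, and all such
  -- monomials are standard.
  refine ⟨(A s).mapDomain ι, hstd _, ?_⟩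
  have h1 : θ (ν.character s) = MvPolynomial.monomial (A s) 1 :=
    AddMonoidAlgebra.mapDomain_single
  rw [AlgHom.comp_apply, h1, hπb, ← MvPolynomial.rename_monomial, MvPolynomial.aeval_rename]
  rfl
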